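/- Let $M$ and $N$ be compact smooth $n$-manifolds without boundary, smoothly embedded in $\mathbb{R}^{n+1}$, with the Riemannian metrics $g_M$, $g_N$ induced by the Euclidean metric, and let $\omega_M$ be the Riemannian volume of $g_M$. Let $G=g_M^*\otimes g_M^*$ be the fibre metric on $T^*M\otimes T^*M$, i.e. $G(B,C)=b_{ij}c_{kl}[g_M]^{ik}[g_M]^{jl}$ in local coordinates. For a diffeomorphism $h:M\to N$ put $$\Phi(h)=\int_M G(h^*g_N-g_M,\;h^*g_N-g_M)\,\omega_M .$$ For a smooth vector field $Y$ on $M$ let $\phi_t$ be its flow, let $L_Y$ be the Lie derivative, $[L_Y\beta]_{ij}=Y^k\partial_k\beta_{ij}+\beta_{kj}\partial_iY^k+\beta_{ik}\partial_jY^k$, and call $h$ a critical point of $\Phi$ if $\frac{d}{dt}\Phi(h\circ\phi_t)\big|_{t=0}$ exists and equals $0$ for every smooth vector field $Y$ on $M$. Let $h:M\to N$ be a $C^\infty$ diffeomorphism. Then: (a) For every smooth vector field $Y$ on $M$, the function $G(h^*g_N-g_M,\,L_Y(h^*g_N))$ is integrable on $M$, the function $t\mapsto\Phi(h\circ\phi_t)$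 is differentiable at $0$, and $$\frac{d}{dt}\Phi(h\circ\phi_t)\Big|_{t=0}=2\int_M G\big(h^*g_N-g_M,\;L_Y(h^*g_N)\big)\,\omega_M .$$ The same value is the derivative at $t=0$ of $\Phi(h_t)$ for every smooth variation $(h_t)_{|t|<\varepsilon}$ of $h$ through diffeomorphisms $M\to N$ (smooth in $(t,p)$, $h_0=h$) with variational field $\frac{\partial}{\partial t}h_t\big|_{t=0}=h_*Y$; that is, it is $D\Phi(h)h_*Y$. (b) $h$ is a critical point of $\Phi$ if and only if $$\int_M G\big(h^*g_N-g_M,\;L_Y(h^*g_N)\big)\,\omega_M=0\qquad\text{for all smooth vector fields } Y \text{ on } M .$$ -/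

import Mathlib

open scoped Manifold ContDiff Topology
open MeasureTheory Set

noncomputable section

namespace BendingEnergy

/-- The coordinate space `ℝⁿ` with its Euclidean structure. -/
abbrev Euc (n : ℕ) : Type := EuclideanSpace ℝ (Fin n)

/-- Bilinear forms on `ℝⁿ`. -/
abbrev BilinOnEuc (n : ℕ) : Type := Euc n →L[ℝ] Euc n →L[ℝ] ℝ

section Tensors

variable {n : ℕ} {M N : Type*} [TopologicalSpace M] [ChartedSpace (Euc n) M]
  [TopologicalSpace N] [ChartedSpace (Euc n) N]

variable (n M) in
/-- Sections (with no regularity required) of `T*M ⊗ T*M`: a bilinear form on each tangent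
space. -/
abbrev TwoTensor : Type _ :=
  (p : M) → TangentSpace (𝓡 n) p →L[ℝ] TangentSpace (𝓡 n) p →L[ℝ] ℝ

variable (n M) in
/-- Vector fields on `M` (with no regularity required). -/
abbrev VecField : Type _ := (p : M) → TangentSpace (𝓡 n) p

/-- `Y ∈ Γ(TM)`: the vector field `Y` is a `C^∞` section of the tangent bundle. -/
def IsSmoothField [IsManifold (𝓡 n) ∞ M] (Y : VecField n M) : Prop :=
  ContMDiff (𝓡 n) (𝓡 n).tangent ∞ (fun p => (⟨p, Y p⟩ : TangentBundle (𝓡 n) M))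

/-- The bilinear form `(v, w) ↦ B (L v) (L w)` on `ℝⁿ`. -/
def pullBilin {m k : ℕ} (B : BilinOnEuc m) (L : Euc k →L[ℝ] Euc m) : BilinOnEuc k :=
  B.bilinearComp L L

/-- The metric induced on `M` by a map `ι : M → ℝⁿ⁺¹`:
`g_p(v, w) = ⟪dι_p v, dι_p w⟫`. -/
def inducedMetric (ι : M → Euc (n + 1)) : TwoTensor n M :=
  fun p => pullBilin (innerSL ℝ) (mfderiv (𝓡 n) (𝓡 (n + 1)) ι p)

/-- The pull-back `f^* β` of a 2-tensor `β` on `N`: `(f^* β)_p(v, w) = β_{f p}(df_p v, df_p w)`. -/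
def pullback (f : M → N) (β : TwoTensor n N) : TwoTensor n M :=
  fun p => pullBilin (β (f p)) (mfderiv (𝓡 n) (𝓡 n) f p)

/-- The inner product `G = g^* ⊗ g^*` of two bilinear forms `B`, `C` on `ℝⁿ`, for an inner product
`g` on `ℝⁿ`: `G(B, C) = ∑ b_{ij} c_{kl} g^{ik} g^{jl}`, with `(g^{ij})` the inverse of the matrix
`(g_{ij})`. The components are taken in the standard basis. -/
def formInner (g B C : BilinOnEuc n) : ℝ :=
  let e : Fin n → Euc n := fun i => EuclideanSpace.single i (1 : ℝ)
  let gInv : Matrix (Fin n) (Fin n) ℝ := (Matrix.of fun i j => g (e i) (e j))⁻¹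
  ∑ i, ∑ j, ∑ k, ∑ l, B (e i) (e j) * C (e k) (e l) * gInv i k * gInv j l

/-- The fibre metric `G` on `T*M ⊗ T*M` determined by the metric `g`. Here `T_pM` is the space
`ℝⁿ` of coordinates in the preferred chart at `p`, and the components are those in the coordinate
basis of this chart. -/
def tensorInner (g B C : TwoTensor n M) (p : M) : ℝ :=
  formInner (n := n) (g p) (B p) (C p)

/-- The representation of a 2-tensor in the chart `x` preferred at `p`, as a map from (the
target of the chart in) `ℝⁿ` to bilinear forms:
`β̂(y)(∂_i, ∂_j) = β_{x⁻¹ y}(∂x⁻¹/∂x^i (y), ∂x⁻¹/∂x^j (y))`. -/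
def coordTensor (β : TwoTensor n M) (p : M) (y : Euc n) : BilinOnEuc n :=
  pullBilin (β ((extChartAt (𝓡 n) p).symm y))
    (mfderiv (𝓡 n) (𝓡 n) (extChartAt (𝓡 n) p).symm y)

/-- The representation of a vector field in the chart `x` preferred at `p`:
`Ŷ(y) = dx (Y (x⁻¹ y))`. -/
def coordField (Y : VecField n M) (p : M) (y : Euc n) : Euc n :=
  (mfderiv (𝓡 n) (𝓡 n) (extChartAt (𝓡 n) p) ((extChartAt (𝓡 n) p).symm y) :
    Euc n →L[ℝ] Euc n) (Y ((extChartAt (𝓡 n) p).symm y))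

/-- The Lie derivative in the chart `x` preferred at `p`, at the point `y` of `ℝⁿ`:
`[L_Y β]_{ij} = Y^k ∂_k β_{ij} + β_{kj} ∂_i Y^k + β_{ik} ∂_j Y^k`, written without indices. -/
def coordLieDeriv (Y : VecField n M) (β : TwoTensor n M) (p : M) (y : Euc n) : BilinOnEuc n :=
  fderiv ℝ (coordTensor β p) y (coordField Y p y)
    + (coordTensor β p y).bilinearComp (fderiv ℝ (coordField Y p) y)
        (ContinuousLinearMap.id ℝ (Euc n))
    + (coordTensor β p y).bilinearComp (ContinuousLinearMap.id ℝ (Euc n))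
        (fderiv ℝ (coordField Y p) y)

/-- The Lie derivative `L_Y β` of the 2-tensor `β`: at `p` it is the bilinear form on `T_pM`
whose components in the chart preferred at `p` are given by the coordinate formula. -/
def lieDeriv (Y : VecField n M) (β : TwoTensor n M) : TwoTensor n M :=
  fun p => pullBilin (coordLieDeriv Y β p (extChartAt (𝓡 n) p p))
    (mfderiv (𝓡 n) (𝓡 n) (extChartAt (𝓡 n) p) p)

end Tensors

section Volume

variable {n : ℕ} {M : Type*} [TopologicalSpace M] [ChartedSpace (Euc n) M]

/-- The density `√det(g_{ij})` at the point `y` of the chart preferred at `c`. -/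
def chartDensity (g : TwoTensor n M) (c : M) (y : Euc n) : ℝ :=
  Real.sqrt (Matrix.of fun i j : Fin n =>
    coordTensor g c y (EuclideanSpace.single i (1 : ℝ))
      (EuclideanSpace.single j (1 : ℝ))).det

variable (n M) in
/-- A smooth partition of unity on `M`, subordinate to the domains of the preferred charts. -/
def chartPartition [IsManifold (𝓡 n) ∞ M] [T2Space M] [SigmaCompactSpace M] :
    SmoothPartitionOfUnity M (𝓡 n) M univ :=
  (SmoothPartitionOfUnity.exists_isSubordinate_chartAt_source (𝓡 n) M).choose

/-- The Riemannian volume measure of the metric `g`: with `(ρ_c)` a partition of unity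
subordinate to charts `(U_c, x_c)`,
`∫ f dμ = ∑_c ∫_{x_c(U_c)} (ρ_c f)(x_c⁻¹ y) √det(g_{ij}(y)) dy`. -/
def volumeMeasure [IsManifold (𝓡 n) ∞ M] [T2Space M] [SigmaCompactSpace M] [MeasurableSpace M]
    (g : TwoTensor n M) : Measure M :=
  Measure.sum fun c : M =>
    Measure.map (extChartAt (𝓡 n) c).symm
      ((volume.restrict (extChartAt (𝓡 n) c).target).withDensity fun y =>
        ENNReal.ofReal (chartPartition n M c ((extChartAt (𝓡 n) c).symm y) * chartDensity g c y))

end Volume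

section Energy

variable {n : ℕ} {M N : Type*} [TopologicalSpace M] [ChartedSpace (Euc n) M]
  [TopologicalSpace N] [ChartedSpace (Euc n) N]

/-- The strain tensor `f^* g_N - g_M`. -/
def strain (gM : TwoTensor n M) (gN : TwoTensor n N) (f : M → N) : TwoTensor n M :=
  fun p => pullback f gN p - gM p

/-- The deformation energy
`Φ(f) = ∫_M G(f^* g_N - g_M, f^* g_N - g_M) ω_M`; the formula is written for an arbitrary map,
and is applied to diffeomorphisms. -/
def energy [IsManifold (𝓡 n) ∞ M] [T2Space M] [SigmaCompactSpace M] [MeasurableSpace M]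
    (gM : TwoTensor n M) (gN : TwoTensor n N) (f : M → N) : ℝ :=
  ∫ p, tensorInner gM (strain gM gN f) (strain gM gN f) p ∂(volumeMeasure gM)

/-- The function `G(h^* g_N - g_M, L_Y h^* g_N)` on `M`. -/
def firstVariationDensity (gM : TwoTensor n M) (gN : TwoTensor n N) (h : M → N)
    (Y : VecField n M) (p : M) : ℝ :=
  tensorInner gM (strain gM gN h) (lieDeriv Y (pullback h gN)) p

/-- `φ` is the (global) flow of `Y`: for each `p`, `t ↦ φ_t(p)` is the integral curve of `Y`
starting at `p`. -/
def IsFlow (Y : VecField n M) (φ : ℝ → M → M) : Prop :=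
  ∀ p, φ 0 p = p ∧ IsMIntegralCurve (I := 𝓡 n) (fun t => φ t p) Y

/-- `(F_t)_{-ε < t < ε}` is a smooth variation of the diffeomorphism `h`. -/
structure IsSmoothVariation (h : M ≃ₘ^∞⟮𝓡 n, 𝓡 n⟯ N) (ε : ℝ) (F : ℝ → M → N) : Prop where
  smooth : ContMDiffOn (𝓘(ℝ, ℝ).prod (𝓡 n)) (𝓡 n) ∞ (fun q : ℝ × M => F q.1 q.2)
    (Ioo (-ε) ε ×ˢ univ)
  diffeo : ∀ t ∈ Ioo (-ε) ε, ∃ d : M ≃ₘ^∞⟮𝓡 n, 𝓡 n⟯ N, F t = d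
  zero : F 0 = h

/-- The variational vector field `V(p) = ∂F/∂t (0, p)` of a variation. -/
def variationField (F : ℝ → M → N) (p : M) : TangentSpace (𝓡 n) (F 0 p) :=
  (mfderiv 𝓘(ℝ, ℝ) (𝓡 n) (fun t => F t p) 0 : ℝ →L[ℝ] Euc n) 1

/-- `h` is a critical point of `Φ`: for each smooth vector field `Y` on `M` with flow `φ_t`, the
derivative of `t ↦ Φ(h ∘ φ_t)` at `t = 0` exists and is zero. -/
def IsCriticalPoint [IsManifold (𝓡 n) ∞ M] [T2Space M] [SigmaCompactSpace M]
    [MeasurableSpace M] (gM : TwoTensor n M) (gN : TwoTensor n N)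
    (h : M ≃ₘ^∞⟮𝓡 n, 𝓡 n⟯ N) : Prop :=
  ∀ Y : VecField n M, IsSmoothField Y → ∀ φ : ℝ → M → M, IsFlow Y φ →
    HasDerivAt (fun t => energy gM gN (h ∘ φ t)) 0 0

end Energy

end BendingEnergy

end

/-!
Since `g_N` is induced by the embedding `ι_N`, the pulled back metric `F_t^* g_N` is the metric
induced on `M` by the map `u_t = ι_N ∘ F_t` to `ℝⁿ⁺¹`. The energy thus depends on the family `u_t`
of maps from `M` to a vector space only, and no charts of `N` are needed.

In a chart of `M`, the energy density is a `C¹` function of the time and the point when `u` is `C²`: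
it is a contraction of `D_y u` with the inverse Gram matrix of `g_M`, which is invertible because an
immersion has injective differential, and the contraction is independent of coordinates
(`formInner_pullBilin`). The volume of `M` is finite, so the energy may be differentiated under the
integral (`IsChartwiseC1.hasDerivAt_integral`). If `∂ₜ u = du_0(Y)` at `t = 0`, the symmetry of
second derivatives gives `∂ₜ D_y u = D²u_0(Y, ·) + Du_0 ∘ DY`, and hence the derivative of the
induced metric is the Lie derivative of the metric induced by `u_0`
(`IsC2Family.hasDerivAt_inducedMetric`). Continuity, and so integrability, of the first variation
density follows from the same computation for the family `u_0 + t • du_0(Y)`, which need not stay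
on the hypersurface `ι_N(N)`.

The formula applies to smooth variations directly, and to `h ∘ φ_t` once the flow `φ` is known to be
jointly `C²` for small times. This smooth dependence on initial points
(`exists_localFlow_contDiffOn`) is proved by Grönwall's inequality and induction on the order of
differentiability, using the system of the equation and its linearisation; compactness makes the
interval of times uniform. Compactness also provides a flow for each smooth field, so that the
vanishing of the derivative of the energy along flows tests the integral for all fields.
-/

noncomputable section

namespace BendingEnergy

/-! ### Smooth dependence of local flows on the initial point -/

section LocalFlow

universe u

/-- Two-sided Grönwall inequality around the time `0`. -/
theorem norm_le_gronwallBound_abs {E : Type*} [NormedAddCommGroup E] [NormedSpace ℝ E]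
    {δ δ' : ℝ → E} {ε K c : ℝ} (hδ : ∀ t ∈ Ioo (-ε) ε, HasDerivAt δ (δ' t) t)
    (hb : ∀ t ∈ Ioo (-ε) ε, ‖δ' t‖ ≤ K * ‖δ t‖ + c) {t : ℝ} (ht : t ∈ Ioo (-ε) ε) :
    ‖δ t‖ ≤ gronwallBound ‖δ 0‖ K c |t| := by
  rcases le_total 0 t with h0 | h0
  · have hsub : ∀ s ∈ Icc 0 t, s ∈ Ioo (-ε) ε := fun s hs => by
      constructor <;> linarith [ht.1, ht.2, hs.1, hs.2]
    have := norm_le_gronwallBound_of_norm_deriv_right_le (f := δ) (f' := δ') (a := 0) (b := t)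
      (fun s hs => (hδ s (hsub s hs)).continuousAt.continuousWithinAt)
      (fun s hs => (hδ s (hsub s (Ico_subset_Icc_self hs))).hasDerivWithinAt) le_rfl
      (fun s hs => hb s (hsub s (Ico_subset_Icc_self hs))) t ⟨h0, le_rfl⟩
    simpa [abs_of_nonneg h0] using this
  · have hsub : ∀ s ∈ Icc 0 (-t), -s ∈ Ioo (-ε) ε := fun s hs => by
      constructor <;> linarith [ht.1, ht.2, hs.1, hs.2]
    have hd : ∀ s ∈ Icc 0 (-t), HasDerivAt (fun s => δ (-s)) (-δ' (-s)) s := fun s hs => by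
      simpa [Function.comp_def] using (hδ (-s) (hsub s hs)).scomp s (hasDerivAt_neg s)
    have := norm_le_gronwallBound_of_norm_deriv_right_le (f := fun s => δ (-s))
      (f' := fun s => -δ' (-s)) (a := 0) (b := -t) (δ := ‖δ 0‖) (K := K) (ε := c)
      (fun s hs => (hd s hs).continuousAt.continuousWithinAt)
      (fun s hs => (hd s (Ico_subset_Icc_self hs)).hasDerivWithinAt) (by simp)
      (fun s hs => by simpa using hb (-s) (hsub s (Ico_subset_Icc_self hs))) (-t)
      ⟨by linarith, le_rfl⟩
    simpa [abs_of_nonpos h0] using this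

/-- `α` is a local flow of the vector field `f`, defined for initial points in `V` and times in
`(-ε, ε)`, and staying in `U`. -/
def IsLocalFlow {E : Type*} [NormedAddCommGroup E] [NormedSpace ℝ E] (f : E → E) (U V : Set E)
    (ε : ℝ) (α : E → ℝ → E) : Prop :=
  ∀ x ∈ V, α x 0 = x ∧ ∀ t ∈ Ioo (-ε) ε, α x t ∈ U ∧ HasDerivAt (α x) (f (α x t)) t

variable {E : Type u} [NormedAddCommGroup E] [NormedSpace ℝ E]

/-- If `A x` solves the linearised equation along the trajectory of `x`, starting from the
identity, then it is the derivative of the flow with respect to the initial point: the error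
`α y - α x - A x (y - x)` satisfies the linearised equation up to `O(‖y - x‖²)`. -/
theorem IsLocalFlow.hasFDerivAt {f : E → E} {U V : Set E} {ε : ℝ} {α : E → ℝ → E}
    (hα : IsLocalFlow f U V ε α) (hV : IsOpen V) (hU : IsOpen U) (hUc : Convex ℝ U) {K K' : NNReal}
    (hfd : ∀ z ∈ U, DifferentiableAt ℝ f z)
    (hf : LipschitzOnWith K f U) (hf' : LipschitzOnWith K' (fderiv ℝ f) U)
    {A : E → ℝ → E →L[ℝ] E}
    (hA : ∀ x ∈ V, A x 0 = ContinuousLinearMap.id ℝ E ∧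
      ∀ t ∈ Ioo (-ε) ε, HasDerivAt (A x) ((fderiv ℝ f (α x t)).comp (A x t)) t)
    {x : E} (hx : x ∈ V) {t : ℝ} (ht : t ∈ Ioo (-ε) ε) :
    HasFDerivAt (fun y => α y t) (A x t) x := by
  -- the flow is Lipschitz in the initial point, uniformly in time
  have hlip : ∀ y ∈ V, ∀ s ∈ Ioo (-ε) ε,
      ‖α y s - α x s‖ ≤ ‖y - x‖ * Real.exp (K * ε) := by
    intro y hy s hs
    have h1 := norm_le_gronwallBound_abs (δ := fun s => α y s - α x s) (K := K) (c := 0)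
      (fun s hs => ((hα y hy).2 s hs).2.sub ((hα x hx).2 s hs).2)
      (fun s hs => by
        simpa using hf.norm_sub_le ((hα y hy).2 s hs).1 ((hα x hx).2 s hs).1) hs
    rw [gronwallBound_ε0, (hα y hy).1, (hα x hx).1] at h1
    refine h1.trans ?_
    have : |s| ≤ ε := abs_le.2 ⟨hs.1.le, hs.2.le⟩
    gcongr
  -- `K + 1` rather than `K`, as `gronwallBound` has a different formula for the rate zero
  have hK : ∀ z ∈ U, ‖fderiv ℝ f z‖ ≤ (K : ℝ) + 1 := fun z hz =>
    (norm_fderiv_le_of_lipschitzOn ℝ (hU.mem_nhds hz) hf).trans (by linarith)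
  -- first order Taylor estimate, from the Lipschitz bound for the derivative
  have htaylor : ∀ y ∈ U, ∀ z ∈ U,
      ‖f y - f z - fderiv ℝ f z (y - z)‖ ≤ K' * ‖y - z‖ * ‖y - z‖ := by
    intro y hy z hz
    have hseg : segment ℝ z y ⊆ U := hUc.segment_subset hz hy
    refine Convex.norm_image_sub_le_of_norm_fderiv_le' (s := segment ℝ z y) (𝕜 := ℝ)
      (fun w hw => hfd w (hseg hw)) (fun w hw => ?_) (convex_segment z y)
      (left_mem_segment ℝ z y) (right_mem_segment ℝ z y)
    refine (hf'.norm_sub_le (hseg hw) hz).trans ?_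
    gcongr
    simpa using norm_sub_le_of_mem_segment hw
  have hmain : ∀ y ∈ V, ‖α y t - α x t - A x t (y - x)‖ ≤
      (K' * Real.exp (K * ε) ^ 2 / ((K : ℝ) + 1) * (Real.exp (((K : ℝ) + 1) * |t|) - 1))
        * ‖y - x‖ ^ 2 := by
    intro y hy
    have h1 := norm_le_gronwallBound_abs (δ := fun s => α y s - α x s - A x s (y - x))
      (δ' := fun s => f (α y s) - f (α x s) - (fderiv ℝ f (α x s)).comp (A x s) (y - x))
      (K := (K : ℝ) + 1) (c := K' * (‖y - x‖ * Real.exp (K * ε)) ^ 2)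
      (fun s hs => (((hα y hy).2 s hs).2.sub ((hα x hx).2 s hs).2).sub
        (((hA x hx).2 s hs).clm_apply (hasDerivAt_const s (y - x)) |>.congr_deriv (by simp)))
      (fun s hs => by
        have hyU := ((hα y hy).2 s hs).1
        have hxU := ((hα x hx).2 s hs).1
        have e : f (α y s) - f (α x s) - (fderiv ℝ f (α x s)).comp (A x s) (y - x) =
            fderiv ℝ f (α x s) (α y s - α x s - A x s (y - x)) +
            (f (α y s) - f (α x s) - fderiv ℝ f (α x s) (α y s - α x s)) := by
          simp only [ContinuousLinearMap.comp_apply, map_sub]; abel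
        rw [e]
        refine (norm_add_le _ _).trans (add_le_add ?_ ?_)
        · exact (ContinuousLinearMap.le_opNorm _ _).trans
            (mul_le_mul_of_nonneg_right (hK _ hxU) (norm_nonneg _))
        · refine (htaylor _ hyU _ hxU).trans ?_
          rw [mul_assoc, ← sq]
          have := hlip y hy s hs
          gcongr) ht
    have hpos : (K : ℝ) + 1 ≠ 0 := by positivity
    rw [(hα y hy).1, (hα x hx).1, (hA x hx).1, gronwallBound_of_K_ne_0 hpos] at h1
    refine h1.trans (le_of_eq ?_)
    simp
    ring
  have hO : HasFDerivAt (fun y => α y t - α x t - A x t (y - x)) (0 : E →L[ℝ] E) x := by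
    refine Asymptotics.IsBigO.hasFDerivAt (n := 2) ?_ one_lt_two
    refine Asymptotics.IsBigO.of_bound
      (K' * Real.exp (K * ε) ^ 2 / ((K : ℝ) + 1) * (Real.exp (((K : ℝ) + 1) * |t|) - 1)) ?_
    filter_upwards [hV.mem_nhds hx] with y hy
    exact (hmain y hy).trans (le_of_eq (by simp))
  have h2 := (hO.add ((A x t).hasFDerivAt (x := x))).add_const (α x t - A x t x)
  rw [zero_add] at h2
  refine h2.congr_of_eventuallyEq (Filter.Eventually.of_forall fun y => ?_)
  simp only [Pi.add_apply, map_sub]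
  abel

/-- A `C^∞` vector field has local flows which are `C^k` in the initial point and time jointly. The
step from `k` to `k + 1` applies the case `k` to the system formed by the equation and its
linearisation, whose flow yields the partial derivatives of the flow of `f`. -/
theorem exists_localFlow_contDiffOn (k : ℕ) :
    ∀ {E : Type u} [NormedAddCommGroup E] [NormedSpace ℝ E] [CompleteSpace E] {f : E → E}
      {U : Set E}, IsOpen U → ContDiffOn ℝ ∞ f U → ∀ {x₀ : E}, x₀ ∈ U →
      ∃ r > 0, ∃ ε > 0, ∃ α : E → ℝ → E, IsLocalFlow f U (Metric.ball x₀ r) ε α ∧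
        ContDiffOn ℝ k (Function.uncurry α) (Metric.ball x₀ r ×ˢ Ioo (-ε) ε) := by
  induction k with
  | zero =>
    intro E _ _ _ f U hU hf x₀ hx₀
    obtain ⟨ε, hε, a, r, L, K, hr, H⟩ := IsPicardLindelof.of_contDiffAt_one
      ((hf.contDiffAt (hU.mem_nhds hx₀)).of_le (by simp))
    obtain ⟨α, hα, hc⟩ := (H 0).exists_forall_mem_closedBall_eq_hasDerivWithinAt_continuousOn
    have hr' : (0 : ℝ) < r := hr
    simp only [zero_sub, zero_add] at hα hc
    have hn : Metric.closedBall x₀ r ×ˢ Icc (-ε) ε ∈ 𝓝 ((x₀, 0) : E × ℝ) :=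
      prod_mem_nhds (Metric.closedBall_mem_nhds _ hr') (Icc_mem_nhds (by linarith) hε)
    have hUn : α ⁻¹' U ∈ 𝓝 ((x₀, 0) : E × ℝ) := by
      refine (hc.continuousAt hn).preimage_mem_nhds (hU.mem_nhds ?_)
      rwa [(hα x₀ (Metric.mem_closedBall_self hr'.le)).1]
    -- by continuity the flow stays in `U` for small times
    obtain ⟨s, hs, hsub⟩ := Metric.mem_nhds_iff.1 (Filter.inter_mem hUn hn)
    rw [← ball_prod_same, Real.ball_eq_Ioo] at hsub
    simp only [zero_sub, zero_add] at hsub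
    refine ⟨s, hs, s, hs, fun x t => α (x, t), fun x hx => ⟨?_, fun t ht => ?_⟩, ?_⟩
    · exact (hα x (hsub (mk_mem_prod hx (⟨by linarith, hs⟩ : (0 : ℝ) ∈ Ioo (-s) s))).2.1).1
    · obtain ⟨h1, h2⟩ := hsub (mk_mem_prod hx ht)
      refine ⟨h1, ((hα x h2.1).2 t h2.2).hasDerivAt ?_⟩
      filter_upwards [Ioo_mem_nhds ht.1 ht.2] with u hu
      exact (hsub (mk_mem_prod hx hu)).2.2
    · rw [Nat.cast_zero, contDiffOn_zero]
      exact hc.mono fun q hq => (hsub hq).2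
  | succ k ih =>
    intro E _ _ _ f U hU hf x₀ hx₀
    have hfd : ContDiffOn ℝ ∞ (fderiv ℝ f) U := hf.fderiv_of_isOpen hU le_rfl
    have hUn := hU.mem_nhds hx₀
    -- near `x₀`, both `f` and its derivative are Lipschitz
    obtain ⟨K, s, hs, hl⟩ :=
      ((hf.contDiffAt hUn).of_le (m := 1) (by simp)).exists_lipschitzOnWith
    obtain ⟨K', s', hs', hl'⟩ :=
      ((hfd.contDiffAt hUn).of_le (m := 1) (by simp)).exists_lipschitzOnWith
    obtain ⟨ρ, hρ, hsub⟩ := Metric.mem_nhds_iff.1 (Filter.inter_mem hUn (Filter.inter_mem hs hs'))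
    set W := Metric.ball x₀ ρ with hW
    have hWU : W ⊆ U := fun z hz => (hsub hz).1
    have hWo : IsOpen W := Metric.isOpen_ball
    -- the equation together with its linearisation
    let g : E × (E →L[ℝ] E) → E × (E →L[ℝ] E) := fun q => (f q.1, (fderiv ℝ f q.1).comp q.2)
    have hg : ContDiffOn ℝ ∞ g (W ×ˢ univ) := by
      have h1 : ContDiffOn ℝ ∞ (fun q : E × (E →L[ℝ] E) => f q.1) (W ×ˢ univ) :=
        hf.comp contDiffOn_fst fun q hq => hWU hq.1
      have h2 : ContDiffOn ℝ ∞ (fun q : E × (E →L[ℝ] E) => fderiv ℝ f q.1) (W ×ˢ univ) :=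
        hfd.comp contDiffOn_fst fun q hq => hWU hq.1
      exact h1.prodMk (h2.clm_comp contDiffOn_snd)
    obtain ⟨r, hr, ε, hε, β, hβ, hβc⟩ := ih (hWo.prod isOpen_univ) hg
      (x₀ := (x₀, ContinuousLinearMap.id ℝ E)) ⟨Metric.mem_ball_self hρ, mem_univ _⟩
    set α : E → ℝ → E := fun x t => (β (x, ContinuousLinearMap.id ℝ E) t).1 with hαdef
    set A : E → ℝ → E →L[ℝ] E := fun x t => (β (x, ContinuousLinearMap.id ℝ E) t).2 with hAdef
    have hin : ∀ x ∈ Metric.ball x₀ r,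
        (x, ContinuousLinearMap.id ℝ E) ∈ Metric.ball (x₀, ContinuousLinearMap.id ℝ E) r := by
      intro x hx
      rw [← ball_prod_same]
      exact ⟨hx, Metric.mem_ball_self hr⟩
    have hα : IsLocalFlow f W (Metric.ball x₀ r) ε α := by
      intro x hx
      have h := hβ _ (hin x hx)
      exact ⟨by simp [hαdef, h.1], fun t ht => ⟨(h.2 t ht).1.1,
        (hasFDerivAt_fst.comp_hasDerivAt t (h.2 t ht).2 :)⟩⟩
    have hA : ∀ x ∈ Metric.ball x₀ r, A x 0 = ContinuousLinearMap.id ℝ E ∧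
        ∀ t ∈ Ioo (-ε) ε, HasDerivAt (A x) ((fderiv ℝ f (α x t)).comp (A x t)) t := by
      intro x hx
      have h := hβ _ (hin x hx)
      exact ⟨by simp [hAdef, h.1], fun t ht =>
        (hasFDerivAt_snd.comp_hasDerivAt t (h.2 t ht).2 :)⟩
    set S : Set (E × ℝ) := Metric.ball x₀ r ×ˢ Ioo (-ε) ε with hS
    have hSo : IsOpen S := Metric.isOpen_ball.prod isOpen_Ioo
    have hβS : ContDiffOn ℝ k
        (fun q : E × ℝ => β (q.1, ContinuousLinearMap.id ℝ E) q.2) S := by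
      have : ContDiff ℝ k (fun q : E × ℝ => ((q.1, ContinuousLinearMap.id ℝ E), q.2)) := by
        fun_prop
      exact hβc.comp this.contDiffOn fun q hq => ⟨hin q.1 hq.1, hq.2⟩
    have hAc : ContDiffOn ℝ k (fun q : E × ℝ => A q.1 q.2) S := hβS.snd
    have hαc : ContDiffOn ℝ k (fun q : E × ℝ => α q.1 q.2) S := hβS.fst
    have hfα : ContDiffOn ℝ k (fun q : E × ℝ => f (α q.1 q.2)) S :=
      (hf.of_le (by exact_mod_cast le_top)).comp hαc
        fun q hq => hWU ((hα q.1 hq.1).2 q.2 hq.2).1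
    let B : E → ℝ → ℝ →L[ℝ] E := fun x t => ContinuousLinearMap.toSpanSingleton ℝ (f (α x t))
    have hBc : ContDiffOn ℝ k (fun q : E × ℝ => B q.1 q.2) S :=
      (ContinuousLinearMap.toSpanSingletonCLE (𝕜 := ℝ) (E := E)).toContinuousLinearMap.contDiff.comp_contDiffOn
        hfα
    refine ⟨r, hr, ε, hε, α, fun x hx => ⟨(hα x hx).1, fun t ht =>
      ⟨hWU ((hα x hx).2 t ht).1, ((hα x hx).2 t ht).2⟩⟩, ?_⟩
    rw [Nat.cast_add, Nat.cast_one, contDiffOn_succ_iff_hasFDerivWithinAt_of_uniqueDiffOn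
      hSo.uniqueDiffOn]
    refine ⟨by simp, fun q => (A q.1 q.2).coprod (B q.1 q.2), ?_, fun q hq => ?_⟩
    · have e : (fun q : E × ℝ => (A q.1 q.2).coprod (B q.1 q.2)) = fun q =>
          (A q.1 q.2).comp (ContinuousLinearMap.fst ℝ E ℝ)
            + (B q.1 q.2).comp (ContinuousLinearMap.snd ℝ E ℝ) := by
        ext q <;> simp
      rw [e]
      exact (hAc.clm_comp contDiffOn_const).add (hBc.clm_comp contDiffOn_const)
    · refine (hasStrictFDerivAt_uncurry_coprod (f := α) (f₁ := A) (f₂ := B) ?_ ?_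
        (hAc.continuousOn.continuousAt (hSo.mem_nhds hq))
        (hBc.continuousOn.continuousAt (hSo.mem_nhds hq))).hasFDerivAt.hasFDerivWithinAt
      · filter_upwards [hSo.mem_nhds hq] with v hv
        exact hα.hasFDerivAt Metric.isOpen_ball hWo (convex_ball _ _)
          (fun z hz => ((hf.contDiffAt (hU.mem_nhds (hWU hz))).differentiableAt (by simp)))
          (hl.mono fun z hz => (hsub hz).2.1) (hl'.mono fun z hz => (hsub hz).2.2) hA hv.1 hv.2
      · filter_upwards [hSo.mem_nhds hq] with v hv
        exact ((hα v.1 hv.1).2 v.2 hv.2).2.hasFDerivAt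

end LocalFlow

/-! ### Inner products of bilinear forms -/

section Forms

variable {n : ℕ}

/-- The matrix of a bilinear form in the standard basis. -/
def bilinMatrix (B : BilinOnEuc n) : Matrix (Fin n) (Fin n) ℝ :=
  Matrix.of fun i j => B (EuclideanSpace.single i (1 : ℝ)) (EuclideanSpace.single j (1 : ℝ))

/-- The matrix of a linear endomorphism in the standard basis. -/
def endMatrix (L : Euc n →L[ℝ] Euc n) : Matrix (Fin n) (Fin n) ℝ :=
  Matrix.of fun i j => L (EuclideanSpace.single j (1 : ℝ)) i

theorem sum_coord_smul_single (v : Euc n) :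
    ∑ i, v i • (EuclideanSpace.single i (1 : ℝ) : Euc n) = v := by
  ext j
  simp [Finset.sum_apply, Pi.single_apply]

theorem endMatrix_id : endMatrix (ContinuousLinearMap.id ℝ (Euc n)) = 1 := by
  ext i j
  simp [endMatrix, Matrix.one_apply]

theorem endMatrix_comp (L L' : Euc n →L[ℝ] Euc n) :
    endMatrix (L.comp L') = endMatrix L * endMatrix L' := by
  ext i j
  simp only [endMatrix, Matrix.of_apply, Matrix.mul_apply, ContinuousLinearMap.comp_apply]
  conv_lhs => rw [← sum_coord_smul_single (L' (EuclideanSpace.single j (1 : ℝ)))]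
  simp [map_sum, mul_comm]

theorem bilinMatrix_pullBilin (B : BilinOnEuc n) (L : Euc n →L[ℝ] Euc n) :
    bilinMatrix (pullBilin B L) = (endMatrix L).transpose * bilinMatrix B * endMatrix L := by
  ext i j
  simp only [bilinMatrix, endMatrix, pullBilin, Matrix.of_apply, Matrix.mul_apply,
    Matrix.transpose_apply, ContinuousLinearMap.bilinearComp_apply]
  conv_lhs => rw [← sum_coord_smul_single (L (EuclideanSpace.single i (1 : ℝ))),
    ← sum_coord_smul_single (L (EuclideanSpace.single j (1 : ℝ)))]
  simp only [map_sum, map_smul, sum_apply, smul_apply,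
    smul_eq_mul, Finset.sum_mul, Finset.mul_sum]
  exact Finset.sum_congr rfl fun a _ => Finset.sum_congr rfl fun b _ => by ring

theorem formInner_eq_trace (g B C : BilinOnEuc n) :
    formInner g B C = ((bilinMatrix B).transpose *
      ((bilinMatrix g)⁻¹ * bilinMatrix C * (bilinMatrix g)⁻¹.transpose)).trace := by
  simp only [formInner, Matrix.trace, Matrix.diag, Matrix.mul_apply, Matrix.transpose_apply,
    Finset.mul_sum, Finset.sum_mul]
  rw [Finset.sum_comm]
  refine Finset.sum_congr rfl fun j _ => Finset.sum_congr rfl fun i _ => ?_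
  rw [Finset.sum_comm]
  refine Finset.sum_congr rfl fun l _ => Finset.sum_congr rfl fun k _ => ?_
  simp only [bilinMatrix, Matrix.of_apply]
  ring

/-- The inner product of bilinear forms does not depend on the choice of coordinates. -/
theorem formInner_pullBilin (g B C : BilinOnEuc n) {L : Euc n →L[ℝ] Euc n}
    (hL : L.IsInvertible) :
    formInner (pullBilin g L) (pullBilin B L) (pullBilin C L) = formInner g B C := by
  have h1 : endMatrix L * endMatrix L.inverse = 1 := by
    rw [← endMatrix_comp, hL.self_comp_inverse, endMatrix_id]
  have h1' : (endMatrix L.inverse).transpose * (endMatrix L).transpose = 1 := by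
    rw [← Matrix.transpose_mul, h1, Matrix.transpose_one]
  have h2 : (endMatrix L)⁻¹ = endMatrix L.inverse := Matrix.inv_eq_right_inv h1
  have h3 : ∀ X, endMatrix L * (endMatrix L.inverse * X) = X := fun X => by
    rw [← Matrix.mul_assoc, h1, Matrix.one_mul]
  have h3' : ∀ X, (endMatrix L.inverse).transpose * ((endMatrix L).transpose * X) = X := fun X => by
    rw [← Matrix.mul_assoc, h1', Matrix.one_mul]
  simp only [formInner_eq_trace, bilinMatrix_pullBilin, Matrix.mul_inv_rev,
    ← Matrix.transpose_nonsing_inv, h2, Matrix.transpose_mul, Matrix.transpose_transpose,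
    Matrix.mul_assoc, h3, h3']
  rw [Matrix.trace_mul_comm]
  simp only [Matrix.mul_assoc, h1', Matrix.mul_one]

/-- The inner product of bilinear forms is symmetric, because the inverse of a symmetric matrix is.
-/
theorem formInner_comm {g : BilinOnEuc n} (hg : ∀ v w, g v w = g w v) (B C : BilinOnEuc n) :
    formInner g B C = formInner g C B := by
  have hs : (bilinMatrix g)⁻¹.transpose = (bilinMatrix g)⁻¹ := by
    rw [Matrix.transpose_nonsing_inv]
    congr 1
    ext i j
    exact hg _ _
  rw [formInner_eq_trace, formInner_eq_trace, hs, ← Matrix.trace_transpose]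
  simp only [Matrix.transpose_mul, Matrix.transpose_transpose, hs]
  rw [Matrix.mul_assoc, Matrix.mul_assoc, Matrix.trace_mul_comm]
  simp only [Matrix.mul_assoc]

theorem hasDerivAt_formInner {g : BilinOnEuc n} (hg : ∀ v w, g v w = g w v)
    {S : ℝ → BilinOnEuc n} {S' : BilinOnEuc n} {t : ℝ}
    (hS : ∀ v w, HasDerivAt (fun s => S s v w) (S' v w) t) :
    HasDerivAt (fun s => formInner g (S s) (S s)) (2 * formInner g (S t) S') t := by
  have h : HasDerivAt (fun s => formInner g (S s) (S s))
      (formInner g S' (S t) + formInner g (S t) S') t := by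
    simp only [formInner, ← Finset.sum_add_distrib, ← add_mul]
    exact HasDerivAt.fun_sum fun i _ => HasDerivAt.fun_sum fun j _ => HasDerivAt.fun_sum fun k _ =>
      HasDerivAt.fun_sum fun l _ =>
        ((((hS _ _).mul (hS _ _)).mul_const _).mul_const _)
  rwa [formInner_comm hg S', ← two_mul] at h

section Smooth

variable {X : Type*} [NormedAddCommGroup X] [NormedSpace ℝ X] {k : ℕ∞ω} {x : X}

theorem ContDiffAt.matrix_det {f : X → Matrix (Fin n) (Fin n) ℝ}
    (hf : ∀ i j, ContDiffAt ℝ k (fun x => f x i j) x) :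
    ContDiffAt ℝ k (fun x => (f x).det) x := by
  simp only [Matrix.det_apply]
  exact ContDiffAt.sum fun σ _ => (contDiffAt_prod fun i _ => hf _ _).const_smul _

theorem ContDiffAt.matrix_inv {f : X → Matrix (Fin n) (Fin n) ℝ}
    (hf : ∀ i j, ContDiffAt ℝ k (fun x => f x i j) x) (hdet : (f x).det ≠ 0) (i j : Fin n) :
    ContDiffAt ℝ k (fun x => (f x)⁻¹ i j) x := by
  simp only [Matrix.inv_def, Ring.inverse_eq_inv', Matrix.smul_apply, smul_eq_mul,
    Matrix.adjugate_apply]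
  refine ((ContDiffAt.matrix_det hf).inv hdet).mul (ContDiffAt.matrix_det fun a b => ?_)
  by_cases h : a = j
  · subst h
    simpa using contDiffAt_const
  · simpa [Matrix.updateRow_ne h] using hf a b

theorem ContDiffAt.formInner {g B C : X → BilinOnEuc n} (hg : ContDiffAt ℝ k g x)
    (hB : ContDiffAt ℝ k B x) (hC : ContDiffAt ℝ k C x) (hdet : (bilinMatrix (g x)).det ≠ 0) :
    ContDiffAt ℝ k (fun x => formInner (g x) (B x) (C x)) x := by
  have happ : ∀ {B : X → BilinOnEuc n}, ContDiffAt ℝ k B x → ∀ v w,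
      ContDiffAt ℝ k (fun x => B x v w) x := fun h v w =>
    (h.clm_apply contDiffAt_const).clm_apply contDiffAt_const
  have hinv := ContDiffAt.matrix_inv (f := fun x => bilinMatrix (g x))
    (fun i j => happ hg _ _) hdet
  exact ContDiffAt.sum fun i _ => ContDiffAt.sum fun j _ => ContDiffAt.sum fun a _ =>
    ContDiffAt.sum fun l _ => (((happ hB _ _).mul (happ hC _ _)).mul (hinv i a)).mul (hinv j l)

theorem ContDiffAt.pullBilin_innerSL {m : ℕ} {W : X → Euc n →L[ℝ] Euc m}
    (hW : ContDiffAt ℝ k W x) : ContDiffAt ℝ k (fun x => pullBilin (innerSL ℝ) (W x)) x := by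
  have hflip : ∀ {p q : ℕ}, ContDiff ℝ k (fun B : Euc p →L[ℝ] Euc q →L[ℝ] ℝ => B.flip) := by
    intro p q
    refine contDiff_clm_apply_iff.2 fun v => contDiff_clm_apply_iff.2 fun w => ?_
    simp only [ContinuousLinearMap.flip_apply]
    fun_prop
  have h1 : ContDiffAt ℝ k (fun x => ((innerSL ℝ).comp (W x)).flip) x :=
    hflip.contDiffAt.comp x (contDiffAt_const.clm_comp hW)
  exact hflip.contDiffAt.comp x (h1.clm_comp hW)

end Smooth

/-- The Gram matrix of an injective linear map is invertible. -/
theorem det_bilinMatrix_pullBilin_innerSL_ne_zero {m : ℕ} {W : Euc n →L[ℝ] Euc m}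
    (hW : Function.Injective W) : (bilinMatrix (pullBilin (innerSL ℝ) W)).det ≠ 0 := by
  intro h
  obtain ⟨v, hv0, hv⟩ := Matrix.exists_mulVec_eq_zero_iff.2 h
  set V : Euc n := WithLp.toLp 2 v with hV
  have hVsum : ∑ i, v i • (EuclideanSpace.single i (1 : ℝ) : Euc n) = V :=
    sum_coord_smul_single V
  have h1 : v ⬝ᵥ ((bilinMatrix (pullBilin (innerSL ℝ) W)).mulVec v) =
      inner ℝ (W V) (W V) := by
    rw [← hVsum]
    simp only [dotProduct, Matrix.mulVec, bilinMatrix, pullBilin, Matrix.of_apply, map_sum,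
      map_smul, sum_inner, inner_sum, inner_smul_left, inner_smul_right,
      ContinuousLinearMap.bilinearComp_apply, Finset.mul_sum]
    refine Finset.sum_congr rfl fun i _ => Finset.sum_congr rfl fun j _ => ?_
    rw [innerSL_apply_apply, real_inner_comm]
    simp only [conj_trivial]
    ring
  rw [hv, dotProduct_zero, eq_comm, inner_self_eq_zero] at h1
  have h2 : V = 0 := hW (by rw [h1, map_zero])
  exact hv0 (by simpa [hV] using h2)

end Forms

/-! ### Tensors in charts -/

section Charts

variable {n : ℕ} {M : Type*} [TopologicalSpace M] [ChartedSpace (Euc n) M]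

theorem inducedMetric_comp {N : Type*} [TopologicalSpace N] [ChartedSpace (Euc n) N]
    {ι : N → Euc (n + 1)} {f : M → N} (hι : MDifferentiable (𝓡 n) (𝓡 (n + 1)) ι)
    (hf : MDifferentiable (𝓡 n) (𝓡 n) f) :
    pullback f (inducedMetric ι) = inducedMetric (ι ∘ f) := by
  funext p
  simp only [pullback, inducedMetric]
  rw [mfderiv_comp p (hι _) (hf p)]
  rfl

/-- A smooth immersion has a local smooth left inverse, hence an injective differential. -/
theorem injective_mfderiv_of_isImmersionAt {ι : M → Euc (n + 1)} {p : M}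
    (hι : Manifold.IsImmersionAt (𝓡 n) (𝓡 (n + 1)) ∞ ι p) :
    Function.Injective (mfderiv (𝓡 n) (𝓡 (n + 1)) ι p) := by
  have hφ : hι.domChart ∈ IsManifold.maximalAtlas (𝓡 n) ∞ M := hι.domChart_mem_maximalAtlas
  have hψ : hι.codChart ∈ IsManifold.maximalAtlas (𝓡 (n + 1)) ∞ (Euc (n + 1)) :=
    hι.codChart_mem_maximalAtlas
  -- in suitable charts `ι` is `y ↦ (y, 0)`, so that projection gives a left inverse `L`
  let P : Euc (n + 1) →L[ℝ] Euc n :=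
    (ContinuousLinearMap.fst ℝ (Euc n) hι.complement).comp
      (hι.equiv.symm : Euc (n + 1) →L[ℝ] Euc n × hι.complement)
  let L : Euc (n + 1) → M := fun z => hι.domChart.symm (P (hι.codChart z))
  have hPι : ∀ q ∈ hι.domChart.source, P (hι.codChart (ι q)) = hι.domChart q := by
    intro q hq
    have h1 : hι.domChart q ∈ (hι.domChart.extend (𝓡 n)).target := by
      simpa using hι.domChart.map_source hq
    have h2 := hι.writtenInCharts h1
    simp only [Function.comp_apply, OpenPartialHomeomorph.extend_coe,
      OpenPartialHomeomorph.extend_coe_symm, modelWithCornersSelf_coe,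
      modelWithCornersSelf_coe_symm, id_eq, hι.domChart.left_inv hq] at h2
    simp [P, h2]
  have hp := hι.mem_domChart_source
  have hLι : L ∘ ι =ᶠ[𝓝 p] id := by
    filter_upwards [hι.domChart.open_source.mem_nhds hp] with q hq
    simp only [L, Function.comp_apply, hPι q hq, hι.domChart.left_inv hq, id_eq]
  have hL : MDifferentiableAt (𝓡 (n + 1)) (𝓡 n) L (ι p) := by
    have h1 : MDifferentiableAt (𝓡 (n + 1)) (𝓡 (n + 1)) hι.codChart (ι p) :=
      ((contMDiffOn_of_mem_maximalAtlas hψ).contMDiffAt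
        (hι.codChart.open_source.mem_nhds hι.mem_codChart_source)).mdifferentiableAt (by simp)
    have h2 : MDifferentiableAt (𝓡 n) (𝓡 n) hι.domChart.symm (P (hι.codChart (ι p))) := by
      rw [hPι p hp]
      exact ((contMDiffOn_symm_of_mem_maximalAtlas hφ).contMDiffAt
        (hι.domChart.open_target.mem_nhds (hι.domChart.map_source hp))).mdifferentiableAt (by simp)
    have h3 : MDifferentiableAt (𝓡 (n + 1)) (𝓡 n) P (hι.codChart (ι p)) :=
      P.differentiableAt.mdifferentiableAt
    exact h2.comp (ι p) (h3.comp (ι p) h1)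
  have hdι : MDifferentiableAt (𝓡 n) (𝓡 (n + 1)) ι p := hι.contMDiffAt.mdifferentiableAt (by simp)
  have h := (hL.hasMFDerivAt.comp p hdι.hasMFDerivAt).congr_of_eventuallyEq hLι.symm
  have h' := hasMFDerivAt_unique h (hasMFDerivAt_id p)
  intro v w hvw
  have e : ∀ v, mfderiv (𝓡 (n + 1)) (𝓡 n) L (ι p) (mfderiv (𝓡 n) (𝓡 (n + 1)) ι p v) = v :=
    fun v => congrArg (fun T : Euc n →L[ℝ] Euc n => T v) h'
  rw [← e v, hvw, e w]

variable [IsManifold (𝓡 n) ∞ M]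

theorem mdifferentiableAt_extChartAt_symm {c : M} {y : Euc n}
    (hy : y ∈ (extChartAt (𝓡 n) c).target) :
    MDifferentiableAt (𝓡 n) (𝓡 n) (extChartAt (𝓡 n) c).symm y := by
  have := mdifferentiableWithinAt_extChartAt_symm (I := 𝓡 n) hy
  rwa [ModelWithCorners.range_eq_univ, mdifferentiableWithinAt_univ] at this

theorem isInvertible_mfderiv_extChartAt_symm {c : M} {y : Euc n}
    (hy : y ∈ (extChartAt (𝓡 n) c).target) :
    (mfderiv (𝓡 n) (𝓡 n) (extChartAt (𝓡 n) c).symm y).IsInvertible := by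
  have := isInvertible_mfderivWithin_extChartAt_symm (I := 𝓡 n) hy
  rwa [ModelWithCorners.range_eq_univ, mfderivWithin_univ] at this

/-- The fibre metric may be computed in any chart. -/
theorem tensorInner_extChartAt_symm (g B C : TwoTensor n M) {c : M} {y : Euc n}
    (hy : y ∈ (extChartAt (𝓡 n) c).target) :
    tensorInner g B C ((extChartAt (𝓡 n) c).symm y) =
      formInner (coordTensor g c y) (coordTensor B c y) (coordTensor C c y) :=
  (formInner_pullBilin _ _ _ (isInvertible_mfderiv_extChartAt_symm hy)).symm

theorem coordTensor_inducedMetric {ι : M → Euc (n + 1)} {c : M} {y : Euc n}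
    (hy : y ∈ (extChartAt (𝓡 n) c).target)
    (hι : MDifferentiableAt (𝓡 n) (𝓡 (n + 1)) ι ((extChartAt (𝓡 n) c).symm y)) :
    coordTensor (inducedMetric ι) c y =
      pullBilin (innerSL ℝ) (fderiv ℝ (ι ∘ (extChartAt (𝓡 n) c).symm) y) := by
  rw [← mfderiv_eq_fderiv, mfderiv_comp y hι (mdifferentiableAt_extChartAt_symm hy)]
  rfl

theorem contDiffOn_comp_extChartAt_symm {k : ℕ∞} {ι : M → Euc (n + 1)}
    (hι : ContMDiff (𝓡 n) (𝓡 (n + 1)) k ι) (c : M) :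
    ContDiffOn ℝ k (ι ∘ (extChartAt (𝓡 n) c).symm) (extChartAt (𝓡 n) c).target := by
  have : IsManifold (𝓡 n) k M := IsManifold.of_le (n := ∞) (by exact_mod_cast le_top)
  exact contMDiffOn_iff_contDiffOn.1 (hι.comp_contMDiffOn (contMDiffOn_extChartAt_symm c))

theorem det_coordTensor_ne_zero {ι : M → Euc (n + 1)}
    (hι : Manifold.IsImmersion (𝓡 n) (𝓡 (n + 1)) ∞ ι) {c : M} {y : Euc n}
    (hy : y ∈ (extChartAt (𝓡 n) c).target) :
    (bilinMatrix (coordTensor (inducedMetric ι) c y)).det ≠ 0 := by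
  have hd : MDifferentiableAt (𝓡 n) (𝓡 (n + 1)) ι ((extChartAt (𝓡 n) c).symm y) :=
    hι.contMDiff.mdifferentiable (by simp) _
  rw [coordTensor_inducedMetric hy hd]
  refine det_bilinMatrix_pullBilin_innerSL_ne_zero ?_
  rw [← mfderiv_eq_fderiv, mfderiv_comp y hd (mdifferentiableAt_extChartAt_symm hy)]
  obtain ⟨e, he⟩ := isInvertible_mfderiv_extChartAt_symm hy
  refine (injective_mfderiv_of_isImmersionAt (hι.isImmersionAt _)).comp ?_
  rw [← he]
  exact e.injective

theorem contDiffOn_coordTensor_inducedMetric {k : ℕ∞} {ι : M → Euc (n + 1)}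
    (hι : ContMDiff (𝓡 n) (𝓡 (n + 1)) (k + 1 : ℕ∞) ι) (c : M) :
    ContDiffOn ℝ k (coordTensor (inducedMetric ι) c) (extChartAt (𝓡 n) c).target := by
  have ho : IsOpen (extChartAt (𝓡 n) c).target := isOpen_extChartAt_target c
  have h1 : ContDiffOn ℝ k (fderiv ℝ (ι ∘ (extChartAt (𝓡 n) c).symm))
      (extChartAt (𝓡 n) c).target :=
    (contDiffOn_comp_extChartAt_symm hι c).fderiv_of_isOpen ho (by simp)
  intro y hy
  refine (ContDiffAt.pullBilin_innerSL
    (h1.contDiffAt (ho.mem_nhds hy))).contDiffWithinAt.congr_of_mem (fun z hz => ?_) hy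
  exact coordTensor_inducedMetric hz (hι.mdifferentiable (by simp) _)

end Charts

/-! ### Finiteness of the volume -/

section Volume

variable {n : ℕ} {M : Type*} [TopologicalSpace M] [ChartedSpace (Euc n) M]
  [IsManifold (𝓡 n) ∞ M]

theorem continuousOn_chartDensity {ι : M → Euc (n + 1)}
    (hι : ContMDiff (𝓡 n) (𝓡 (n + 1)) 1 ι) (c : M) :
    ContinuousOn (chartDensity (inducedMetric ι) c) (extChartAt (𝓡 n) c).target := by
  have h := (contDiffOn_coordTensor_inducedMetric (k := 0) (by simpa using hι) c).continuousOn
  have hm : ContinuousOn (fun y => bilinMatrix (coordTensor (inducedMetric ι) c y))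
      (extChartAt (𝓡 n) c).target := by
    refine continuousOn_pi.2 fun i => continuousOn_pi.2 fun j => ?_
    exact (h.clm_apply continuousOn_const).clm_apply continuousOn_const
  exact Real.continuous_sqrt.comp_continuousOn (continuous_id.matrix_det.comp_continuousOn hm)

/-- The volume of a compact manifold is finite: finitely many functions of the partition of unity
are nonzero, and each has compact support in its chart. -/
theorem isFiniteMeasure_volumeMeasure [T2Space M] [CompactSpace M] [MeasurableSpace M]
    {ι : M → Euc (n + 1)} (hι : ContMDiff (𝓡 n) (𝓡 (n + 1)) 1 ι) :
    IsFiniteMeasure (volumeMeasure (inducedMetric ι)) := by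
  have hsub := (SmoothPartitionOfUnity.exists_isSubordinate_chartAt_source (𝓡 n) M).choose_spec
  have hfin := (chartPartition n M).locallyFinite.finite_nonempty_of_compact
  refine ⟨?_⟩
  rw [volumeMeasure, Measure.sum_apply _ MeasurableSet.univ, tsum_eq_sum (s := hfin.toFinset)]
  · refine ENNReal.sum_lt_top.2 fun c _ => ?_
    refine lt_of_le_of_lt (b := ((volume.restrict (extChartAt (𝓡 n) c).target).withDensity fun y =>
        ENNReal.ofReal (chartPartition n M c ((extChartAt (𝓡 n) c).symm y) *
          chartDensity (inducedMetric ι) c y)) univ) ?_ ?_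
    -- the bound holds also for the junk value `0` of the push-forward by a non-measurable map
    · by_cases h : AEMeasurable (extChartAt (𝓡 n) c).symm
          ((volume.restrict (extChartAt (𝓡 n) c).target).withDensity fun y =>
            ENNReal.ofReal (chartPartition n M c ((extChartAt (𝓡 n) c).symm y) *
              chartDensity (inducedMetric ι) c y))
      · rw [Measure.map_apply_of_aemeasurable h MeasurableSet.univ, preimage_univ]
      · rw [Measure.map_of_not_aemeasurable h]
        exact bot_le
    · rw [withDensity_apply _ MeasurableSet.univ, Measure.restrict_univ]
      have htsub : tsupport (chartPartition n M c) ⊆ (extChartAt (𝓡 n) c).source := by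
        rw [extChartAt_source]; exact hsub c
      set K := extChartAt (𝓡 n) c '' tsupport (chartPartition n M c) with hK
      have hKc : IsCompact K :=
        ((isClosed_tsupport _).isCompact).image_of_continuousOn
          ((continuousOn_extChartAt c).mono htsub)
      have hKt : K ⊆ (extChartAt (𝓡 n) c).target := by
        rintro _ ⟨q, hq, rfl⟩
        exact (extChartAt (𝓡 n) c).map_source (htsub hq)
      obtain ⟨C, hC⟩ := hKc.exists_bound_of_continuousOn ((continuousOn_chartDensity hι c).mono hKt)
      calc ∫⁻ y in (extChartAt (𝓡 n) c).target, ENNReal.ofReal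
            (chartPartition n M c ((extChartAt (𝓡 n) c).symm y) *
              chartDensity (inducedMetric ι) c y)
          ≤ ∫⁻ y in (extChartAt (𝓡 n) c).target, K.indicator (fun _ => ENNReal.ofReal C) y := by
            refine setLIntegral_mono' (isOpen_extChartAt_target c).measurableSet fun y hy => ?_
            by_cases hyK : y ∈ K
            · rw [indicator_of_mem hyK]
              refine ENNReal.ofReal_le_ofReal ?_
              have h1 := (chartPartition n M).le_one c ((extChartAt (𝓡 n) c).symm y)
              have h2 : 0 ≤ chartDensity (inducedMetric ι) c y := Real.sqrt_nonneg _
              calc _ ≤ 1 * chartDensity (inducedMetric ι) c y := by gcongr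
                _ ≤ C := by rw [one_mul]; exact (le_abs_self _).trans (hC y hyK)
            · have : chartPartition n M c ((extChartAt (𝓡 n) c).symm y) = 0 := by
                by_contra hne
                exact hyK ⟨_, subset_tsupport _ hne, (extChartAt (𝓡 n) c).right_inv hy⟩
              rw [this, zero_mul, ENNReal.ofReal_zero]
              exact bot_le
        _ ≤ ∫⁻ y, K.indicator (fun _ => ENNReal.ofReal C) y := setLIntegral_le_lintegral _ _
        _ < ⊤ := by
            rw [lintegral_indicator hKc.measurableSet, setLIntegral_const]
            exact ENNReal.mul_lt_top ENNReal.ofReal_lt_top hKc.measure_lt_top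
  · intro c hc
    have h0 : ∀ q, chartPartition n M c q = 0 := by
      intro q
      by_contra hne
      exact hc (hfin.mem_toFinset.2 ⟨q, hne⟩)
    simp [h0]

end Volume

/-! ### Mixed second derivatives -/

section SecondDerivatives

variable {E F : Type*} [NormedAddCommGroup E] [NormedSpace ℝ E] [NormedAddCommGroup F]
  [NormedSpace ℝ F]

theorem fderiv_section_right {u : ℝ × E → F} {t : ℝ} {y : E} (hu : DifferentiableAt ℝ u (t, y)) :
    fderiv ℝ (fun z => u (t, z)) y = (fderiv ℝ u (t, y)).comp (ContinuousLinearMap.inr ℝ ℝ E) :=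
  (hu.hasFDerivAt.comp y (hasFDerivAt_prodMk_right t y)).fderiv

theorem hasDerivAt_section_left {u : ℝ × E → F} {t : ℝ} {y : E}
    (hu : DifferentiableAt ℝ u (t, y)) :
    HasDerivAt (fun s => u (s, y)) (fderiv ℝ u (t, y) (1, 0)) t := by
  simpa [Function.comp_def] using (hu.hasFDerivAt.comp t (hasFDerivAt_prodMk_left t y)).hasDerivAt

/-- If `∂ₜ u = D_y u · Y` at time `0`, then `∂ₜ D_y u = D²_y u · Y + D_y u · DY` at time `0`, by the
symmetry of second derivatives. -/
theorem hasDerivAt_fderiv_of_deriv_eq {u : ℝ × E → F} {Y : E → E} {y : E}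
    (hu : ContDiffAt ℝ 2 u (0, y)) (hY : DifferentiableAt ℝ Y y)
    (huY : ∀ᶠ z in 𝓝 y, HasDerivAt (fun t => u (t, z)) (fderiv ℝ (fun z => u (0, z)) z (Y z)) 0)
    (v : E) :
    HasDerivAt (fun t => fderiv ℝ (fun z => u (t, z)) y v)
      (fderiv ℝ (fderiv ℝ fun z => u (0, z)) y (Y y) v
        + fderiv ℝ (fun z => u (0, z)) y (fderiv ℝ Y y v)) 0 := by
  have hev : ∀ᶠ q in 𝓝 ((0, y) : ℝ × E), DifferentiableAt ℝ u q := by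
    filter_upwards [hu.eventually (by simp)] with q hq using hq.differentiableAt (by simp)
  have hevt : ∀ᶠ t in 𝓝 (0 : ℝ), DifferentiableAt ℝ u (t, y) :=
    (Continuous.prodMk_left y).continuousAt.eventually hev
  have hevy : ∀ᶠ z in 𝓝 y, DifferentiableAt ℝ u (0, z) :=
    (Continuous.prodMk_right (0 : ℝ)).continuousAt.eventually hev
  have hD : DifferentiableAt ℝ (fderiv ℝ u) (0, y) :=
    (hu.fderiv_right (m := 1) (by norm_num)).differentiableAt (by simp)
  have hsymm : IsSymmSndFDerivAt ℝ u (0, y) := hu.isSymmSndFDerivAt (by simp)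
  -- the derivative in time of the derivative in space
  have h1 : HasDerivAt (fun t => fderiv ℝ u (t, y) (0, v))
      (fderiv ℝ (fderiv ℝ u) (0, y) (1, 0) (0, v)) 0 := by
    simpa using (hasDerivAt_section_left hD).clm_apply (hasDerivAt_const (0 : ℝ) ((0, v) : ℝ × E))
  have h1' : HasDerivAt (fun t => fderiv ℝ (fun z => u (t, z)) y v)
      (fderiv ℝ (fderiv ℝ u) (0, y) (1, 0) (0, v)) 0 := by
    refine h1.congr_of_eventuallyEq ?_
    filter_upwards [hevt] with t ht
    simp [fderiv_section_right ht]
  -- differentiation of the hypothesis in space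
  have h2 : (fun z => fderiv ℝ u (0, z) (1, 0)) =ᶠ[𝓝 y] fun z => fderiv ℝ u (0, z) (0, Y z) := by
    filter_upwards [huY, hevy] with z hz hd
    rw [(hasDerivAt_section_left hd).unique hz, fderiv_section_right hd]
    simp
  have hDy : HasFDerivAt (fun z => fderiv ℝ u (0, z))
      ((fderiv ℝ (fderiv ℝ u) (0, y)).comp (ContinuousLinearMap.inr ℝ ℝ E)) y :=
    hD.hasFDerivAt.comp y (hasFDerivAt_prodMk_right 0 y)
  have h3 : HasFDerivAt (fun z => fderiv ℝ u (0, z) (0, Y z)) _ y :=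
    hDy.clm_apply ((hasFDerivAt_prodMk_right (0 : ℝ) (Y y)).comp y hY.hasFDerivAt)
  have h4 : HasFDerivAt (fun z => fderiv ℝ u (0, z) (1, 0)) _ y :=
    hDy.clm_apply (hasFDerivAt_const ((1, 0) : ℝ × E) y)
  have h5 := congrArg (fun T => T v) ((h4.congr_of_eventuallyEq h2.symm).unique h3)
  simp only [ContinuousLinearMap.comp_zero, zero_add, ContinuousLinearMap.flip_apply,
    ContinuousLinearMap.comp_apply, ContinuousLinearMap.inr_apply, add_apply] at h5
  have h6 : (fderiv ℝ (fun z => u (0, z))) =ᶠ[𝓝 y]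
      fun z => (fderiv ℝ u (0, z)).comp (ContinuousLinearMap.inr ℝ ℝ E) := by
    filter_upwards [hevy] with z hz using fderiv_section_right hz
  have h7 : fderiv ℝ (fderiv ℝ fun z => u (0, z)) y (Y y) v =
      fderiv ℝ (fderiv ℝ u) (0, y) (0, v) (0, Y y) := by
    rw [h6.fderiv_eq, ((hDy.clm_comp (hasFDerivAt_const _ _))).fderiv]
    simp [hsymm.eq (0, v) (0, Y y)]
  have h8 : fderiv ℝ (fderiv ℝ u) (0, y) (1, 0) (0, v) =
      fderiv ℝ (fderiv ℝ fun z => u (0, z)) y (Y y) v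
        + fderiv ℝ (fun z => u (0, z)) y (fderiv ℝ Y y v) := by
    rw [h7, hsymm.eq (1, 0) (0, v), h6.eq_of_nhds]
    simp at h5 ⊢
    rw [h5, add_comm]
  exact h8 ▸ h1'

end SecondDerivatives

/-! ### Differentiation under the integral sign -/

section Integral

variable {n : ℕ} {M : Type*} [TopologicalSpace M] [ChartedSpace (Euc n) M]

/-- A family of functions on `M`, for times in `(-ε, ε)`, which is `C¹` in the time and the point
jointly, in the chart preferred at each point. -/
def IsChartwiseC1 (ε : ℝ) (e : ℝ → M → ℝ) : Prop :=
  ∀ c : M, ContDiffOn ℝ 1 (fun q : ℝ × Euc n => e q.1 ((extChartAt (𝓡 n) c).symm q.2))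
    (Ioo (-ε) ε ×ˢ (extChartAt (𝓡 n) c).target)

theorem isOpen_Ioo_prod_target (ε : ℝ) (c : M) :
    IsOpen (Ioo (-ε) ε ×ˢ (extChartAt (𝓡 n) c).target) :=
  isOpen_Ioo.prod (isOpen_extChartAt_target c)

theorem mk_extChartAt_mem {ε t : ℝ} (ht : t ∈ Ioo (-ε) ε) {c p : M}
    (hp : p ∈ (extChartAt (𝓡 n) c).source) :
    (t, extChartAt (𝓡 n) c p) ∈ Ioo (-ε) ε ×ˢ (extChartAt (𝓡 n) c).target :=
  ⟨ht, (extChartAt (𝓡 n) c).map_source hp⟩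

variable {ε : ℝ} {e : ℝ → M → ℝ}

theorem IsChartwiseC1.hasDerivAt (he : IsChartwiseC1 (n := n) ε e) {t : ℝ} (ht : t ∈ Ioo (-ε) ε)
    {c p : M} (hp : p ∈ (extChartAt (𝓡 n) c).source) :
    HasDerivAt (fun s => e s p) (fderiv ℝ
      (fun q : ℝ × Euc n => e q.1 ((extChartAt (𝓡 n) c).symm q.2)) (t, extChartAt (𝓡 n) c p) (1, 0))
      t := by
  have h := hasDerivAt_section_left (((he c).contDiffAt ((isOpen_Ioo_prod_target ε c).mem_nhds
    (mk_extChartAt_mem ht hp))).differentiableAt (by simp))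
  simpa only [(extChartAt (𝓡 n) c).left_inv hp] using h

/-- A function of time and point is continuous if it is continuous in every chart. -/
theorem continuousOn_of_chartwise {f : ℝ → M → ℝ} {f' : M → ℝ × Euc n → ℝ}
    (hf' : ∀ c, ContinuousOn (f' c) (Ioo (-ε) ε ×ˢ (extChartAt (𝓡 n) c).target))
    (hf : ∀ c, ∀ t ∈ Ioo (-ε) ε, ∀ p ∈ (extChartAt (𝓡 n) c).source,
      f t p = f' c (t, extChartAt (𝓡 n) c p)) :
    ContinuousOn (fun q : ℝ × M => f q.1 q.2) (Ioo (-ε) ε ×ˢ univ) := by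
  rintro ⟨t, c⟩ ⟨ht, -⟩
  have hc : c ∈ (extChartAt (𝓡 n) c).source := mem_extChartAt_source c
  have h1 : ContinuousAt (fun q : ℝ × M => f' c (q.1, extChartAt (𝓡 n) c q.2)) (t, c) :=
    ((hf' c).continuousAt ((isOpen_Ioo_prod_target ε c).mem_nhds (mk_extChartAt_mem ht hc))).comp
      (f := fun q : ℝ × M => (q.1, extChartAt (𝓡 n) c q.2))
      (continuousAt_fst.prodMk (ContinuousAt.comp (f := Prod.snd) (x := (t, c))
        (continuousAt_extChartAt (I := 𝓡 n) c) continuousAt_snd))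
  refine (h1.congr ?_).continuousWithinAt
  filter_upwards [prod_mem_nhds (Ioo_mem_nhds ht.1 ht.2) (extChartAt_source_mem_nhds (I := 𝓡 n) c)]
    with q hq
  exact (hf c q.1 hq.1 q.2 hq.2).symm

theorem IsChartwiseC1.continuousOn (he : IsChartwiseC1 (n := n) ε e) :
    ContinuousOn (fun q : ℝ × M => e q.1 q.2) (Ioo (-ε) ε ×ˢ univ) :=
  continuousOn_of_chartwise (fun c => (he c).continuousOn) fun c t _ p hp => by
    simp only [(extChartAt (𝓡 n) c).left_inv hp]

theorem IsChartwiseC1.continuousOn_deriv (he : IsChartwiseC1 (n := n) ε e) :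
    ContinuousOn (fun q : ℝ × M => deriv (fun s => e s q.2) q.1) (Ioo (-ε) ε ×ˢ univ) := by
  refine continuousOn_of_chartwise (n := n) (f := fun t p => deriv (fun s => e s p) t)
    (f' := fun c q => fderiv ℝ
      (fun q : ℝ × Euc n => e q.1 ((extChartAt (𝓡 n) c).symm q.2)) q (1, 0))
    (fun c => ?_) fun c t ht p hp => (he.hasDerivAt ht hp).deriv
  exact (((he c).fderiv_of_isOpen (m := 0) (isOpen_Ioo_prod_target ε c)
    (by simp)).continuousOn).clm_apply continuousOn_const

theorem IsChartwiseC1.continuous_deriv_zero (he : IsChartwiseC1 (n := n) ε e) (hε : 0 < ε) :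
    Continuous fun p => deriv (fun s => e s p) 0 := by
  rw [← continuousOn_univ]
  exact he.continuousOn_deriv.comp (f := fun p : M => ((0 : ℝ), p))
    (Continuous.prodMk_right (0 : ℝ)).continuousOn fun p _ => ⟨⟨by simpa, hε⟩, mem_univ p⟩

theorem integrable_of_continuous_of_compact [CompactSpace M] [MeasurableSpace M] [BorelSpace M]
    {μ : Measure M} [IsFiniteMeasure μ] {f : M → ℝ} (hf : Continuous f) : Integrable f μ := by
  obtain ⟨C, hC⟩ := isCompact_univ.exists_bound_of_continuousOn hf.continuousOn
  exact Integrable.of_bound hf.aestronglyMeasurable C (ae_of_all _ fun p => hC p (mem_univ p))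

/-- On a compact manifold, a family which is `C¹` in charts may be differentiated under the
integral. -/
theorem IsChartwiseC1.hasDerivAt_integral [CompactSpace M] [MeasurableSpace M] [BorelSpace M]
    {μ : Measure M} [IsFiniteMeasure μ] (he : IsChartwiseC1 (n := n) ε e) (hε : 0 < ε) :
    HasDerivAt (fun t => ∫ p, e t p ∂μ) (∫ p, deriv (fun s => e s p) 0 ∂μ) 0 := by
  have hsub : Icc (-(ε / 2)) (ε / 2) ⊆ Ioo (-ε) ε := fun t ht =>
    ⟨by linarith [ht.1], by linarith [ht.2]⟩
  have hcont : ∀ t ∈ Ioo (-ε) ε, Continuous (e t) := by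
    intro t ht
    rw [← continuousOn_univ]
    exact he.continuousOn.comp (f := fun p : M => (t, p))
      (Continuous.prodMk_right t).continuousOn fun p _ => ⟨ht, mem_univ p⟩
  have h0 : (0 : ℝ) ∈ Ioo (-ε) ε := ⟨by simpa, hε⟩
  obtain ⟨C, hC⟩ := (isCompact_Icc.prod isCompact_univ).exists_bound_of_continuousOn
    (he.continuousOn_deriv.mono (prod_mono hsub Subset.rfl))
  refine (hasDerivAt_integral_of_dominated_loc_of_deriv_le (bound := fun _ => C)
    (s := Icc (-(ε / 2)) (ε / 2)) (F' := fun t p => deriv (fun s => e s p) t)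
    (Icc_mem_nhds (by linarith) (by linarith)) ?_
    (integrable_of_continuous_of_compact (hcont 0 h0))
    (he.continuous_deriv_zero hε).aestronglyMeasurable
    (ae_of_all _ fun p t ht => hC (t, p) ⟨ht, mem_univ p⟩) (integrable_const C)
    (ae_of_all _ fun p t ht => ?_)).2
  · filter_upwards [Ioo_mem_nhds h0.1 h0.2] with t ht using (hcont t ht).aestronglyMeasurable
  · have h := he.hasDerivAt (hsub ht) (mem_extChartAt_source (I := 𝓡 n) p)
    rwa [← h.deriv] at h

end Integral

/-! ### Regularity of the energy density of a family of maps -/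

section Variation

variable {n : ℕ} {M : Type*} [TopologicalSpace M] [ChartedSpace (Euc n) M]

/-- The energy density of a map `v` of `M` to `ℝⁿ⁺¹`: the squared norm of the difference of the
metric induced by `v` and `g`. -/
def mapEnergyDensity (g : TwoTensor n M) (v : M → Euc (n + 1)) (p : M) : ℝ :=
  tensorInner g (fun q => inducedMetric v q - g q) (fun q => inducedMetric v q - g q) p

/-- A `C²` family of maps `u t : M → ℝⁿ⁺¹`, for `-ε < t < ε`. -/
def IsC2Family (n : ℕ) {M : Type*} [TopologicalSpace M] [ChartedSpace (Euc n) M] (ε : ℝ)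
    (u : ℝ → M → Euc (n + 1)) : Prop :=
  ContMDiffOn (𝓘(ℝ, ℝ).prod (𝓡 n)) (𝓡 (n + 1)) 2 (fun q : ℝ × M => u q.1 q.2)
    (Ioo (-ε) ε ×ˢ univ)

variable {ε : ℝ} {u : ℝ → M → Euc (n + 1)}

theorem IsC2Family.contMDiff (hu : IsC2Family n ε u) {t : ℝ} (ht : t ∈ Ioo (-ε) ε) :
    ContMDiff (𝓡 n) (𝓡 (n + 1)) 2 (u t) := by
  rw [← contMDiffOn_univ]
  exact ContMDiffOn.comp hu (f := fun p : M => (t, p))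
    (contMDiff_const.prodMk contMDiff_id).contMDiffOn fun p _ => ⟨ht, mem_univ p⟩

theorem coordTensor_sub (A B : TwoTensor n M) (c : M) (y : Euc n) :
    coordTensor (fun q => A q - B q) c y = coordTensor A c y - coordTensor B c y := by
  ext v w
  rfl

variable [IsManifold (𝓡 n) ∞ M]

theorem IsC2Family.contDiffOn (hu : IsC2Family n ε u) (c : M) :
    ContDiffOn ℝ 2 (fun q : ℝ × Euc n => u q.1 ((extChartAt (𝓡 n) c).symm q.2))
      (Ioo (-ε) ε ×ˢ (extChartAt (𝓡 n) c).target) := by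
  have h2 : IsManifold (𝓡 n) 2 M :=
    IsManifold.of_le (n := ∞) (mod_cast le_top : ((2 : ℕ∞) : ℕ∞ω) ≤ ∞)
  rw [← contMDiffOn_iff_contDiffOn]
  refine ContMDiffOn.comp hu (f := fun q : ℝ × Euc n => (q.1, (extChartAt (𝓡 n) c).symm q.2))
    (ContMDiffOn.prodMk contDiff_fst.contMDiff.contMDiffOn ?_) fun q hq => ⟨hq.1, mem_univ _⟩
  exact (contMDiffOn_extChartAt_symm c).comp (contDiff_snd.contMDiff.contMDiffOn) fun q hq => hq.2

theorem IsC2Family.isChartwiseC1_mapEnergyDensity (hu : IsC2Family n ε u) {ι : M → Euc (n + 1)}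
    (hι : Manifold.IsImmersion (𝓡 n) (𝓡 (n + 1)) ∞ ι) :
    IsChartwiseC1 (n := n) ε fun t => mapEnergyDensity (inducedMetric ι) (u t) := by
  intro c
  have ho := isOpen_Ioo_prod_target (n := n) ε c
  have hD : ContDiffOn ℝ 1
      (fderiv ℝ fun q : ℝ × Euc n => u q.1 ((extChartAt (𝓡 n) c).symm q.2))
      (Ioo (-ε) ε ×ˢ (extChartAt (𝓡 n) c).target) :=
    (hu.contDiffOn c).fderiv_of_isOpen ho (by norm_num)
  have hg : ContDiffOn ℝ 1 (coordTensor (inducedMetric ι) c) (extChartAt (𝓡 n) c).target :=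
    contDiffOn_coordTensor_inducedMetric (k := 1) (hι.contMDiff.of_le (by exact_mod_cast le_top)) c
  intro q hq
  have hgq : ContDiffAt ℝ 1 (fun q : ℝ × Euc n => coordTensor (inducedMetric ι) c q.2) q :=
    (hg.contDiffAt ((isOpen_extChartAt_target c).mem_nhds hq.2)).comp q contDiffAt_snd
  have hW : ContDiffAt ℝ 1 (fun q => (fderiv ℝ (fun q : ℝ × Euc n =>
      u q.1 ((extChartAt (𝓡 n) c).symm q.2)) q).comp (ContinuousLinearMap.inr ℝ ℝ (Euc n))) q :=
    (hD.contDiffAt (ho.mem_nhds hq)).clm_comp contDiffAt_const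
  have hS := (ContDiffAt.pullBilin_innerSL hW).sub hgq
  refine (ContDiffAt.formInner hgq hS hS
    (det_coordTensor_ne_zero hι hq.2)).contDiffWithinAt.congr_of_mem (fun z hz => ?_) hq
  have hz' : DifferentiableAt ℝ (fun q : ℝ × Euc n => u q.1 ((extChartAt (𝓡 n) c).symm q.2))
      (z.1, z.2) := ((hu.contDiffOn c).contDiffAt (ho.mem_nhds hz)).differentiableAt (by simp)
  simp only [mapEnergyDensity]
  rw [tensorInner_extChartAt_symm _ _ _ hz.2, coordTensor_sub,
    coordTensor_inducedMetric (ι := u z.1) hz.2 ((hu.contMDiff hz.1).mdifferentiable (by simp) _),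
    ← fderiv_section_right hz']
  rfl

/-- The coordinate representation of the derivative of a map along a vector field. -/
theorem fderiv_coordField {v : M → Euc (n + 1)} (hv : MDifferentiable (𝓡 n) (𝓡 (n + 1)) v)
    (Y : VecField n M) {c : M} {y : Euc n} (hy : y ∈ (extChartAt (𝓡 n) c).target) :
    fderiv ℝ (v ∘ (extChartAt (𝓡 n) c).symm) y (coordField Y c y) =
      mfderiv (𝓡 n) (𝓡 (n + 1)) v ((extChartAt (𝓡 n) c).symm y)
        (Y ((extChartAt (𝓡 n) c).symm y)) := by
  have h := mfderivWithin_extChartAt_symm_comp_mfderiv_extChartAt (I := 𝓡 n) hy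
  rw [ModelWithCorners.range_eq_univ, mfderivWithin_univ] at h
  have h' := congrArg (fun T : Euc n →L[ℝ] Euc n => T (Y ((extChartAt (𝓡 n) c).symm y))) h
  rw [← mfderiv_eq_fderiv, mfderiv_comp y (hv _) (mdifferentiableAt_extChartAt_symm hy)]
  exact congrArg (mfderiv (𝓡 n) (𝓡 (n + 1)) v ((extChartAt (𝓡 n) c).symm y)) h'

/-- In a chart, a vector field is read off by the trivialization of the tangent bundle given by the
chart. -/
theorem contDiffOn_coordField {Y : VecField n M} (hY : IsSmoothField Y) (c : M) :
    ContDiffOn ℝ ∞ (coordField Y c) (extChartAt (𝓡 n) c).target := by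
  have h1 : ContMDiffOn (𝓡 n) (𝓡 n) ∞
      (fun p => (trivializationAt (Euc n) (TangentSpace (𝓡 n)) c ⟨p, Y p⟩).2)
      (chartAt (Euc n) c).source := by
    have := ((trivializationAt (Euc n) (TangentSpace (𝓡 n) (M := M)) c
      ).contMDiffOn_section_baseSet_iff (IB := 𝓡 n) (n := ∞) (s := Y)).1 hY.contMDiffOn
    simpa using this
  rw [← contMDiffOn_iff_contDiffOn]
  refine (h1.comp (contMDiffOn_extChartAt_symm c) fun y hy => ?_).congr fun y hy => ?_
  · rw [mem_preimage, ← extChartAt_source (𝓡 n)]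
    exact (extChartAt (𝓡 n) c).map_target hy
  · have hs : (extChartAt (𝓡 n) c).symm y ∈ (chartAt (Euc n) c).source := by
      rw [← extChartAt_source (𝓡 n)]
      exact (extChartAt (𝓡 n) c).map_target hy
    have h2 := TangentBundle.continuousLinearMapAt_trivializationAt (I := 𝓡 n) hs
    have h3 := congrArg (fun T : Euc n →L[ℝ] Euc n => T (Y ((extChartAt (𝓡 n) c).symm y))) h2
    refine h3.symm.trans ?_
    exact Bundle.Trivialization.continuousLinearMapAt_apply_of_mem (R := ℝ)
      (e := trivializationAt (Euc n) (TangentSpace (𝓡 n) (M := M)) c) (by simpa using hs) _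

end Variation

/-! ### First variation of induced metrics and of their energy -/

section FirstVariation

variable {n : ℕ} {M : Type*} [TopologicalSpace M] [ChartedSpace (Euc n) M]

/-- The differential at `p` of a map to `ℝⁿ⁺¹`, as a linear map on the coordinate space `ℝⁿ` of the
preferred chart at `p`. -/
def coordDifferential (v : M → Euc (n + 1)) (p : M) : Euc n →L[ℝ] Euc (n + 1) :=
  mfderiv (𝓡 n) (𝓡 (n + 1)) v p

theorem coordDifferential_eq {v : M → Euc (n + 1)} {p : M}
    (hv : MDifferentiableAt (𝓡 n) (𝓡 (n + 1)) v p) :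
    coordDifferential v p = fderiv ℝ (v ∘ (extChartAt (𝓡 n) p).symm) (extChartAt (𝓡 n) p p) := by
  rw [coordDifferential, hv.mfderiv, ModelWithCorners.range_eq_univ, fderivWithin_univ]
  rfl

/-- The variation of a map `v` to `ℝⁿ⁺¹` by straight lines with velocity `dv(Y)`. -/
def straightVariation (v : M → Euc (n + 1)) (Y : VecField n M) (t : ℝ) (p : M) : Euc (n + 1) :=
  v p + t • (coordDifferential v p (Y p))

theorem straightVariation_zero (v : M → Euc (n + 1)) (Y : VecField n M) :
    straightVariation v Y 0 = v := by
  funext p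
  simp [straightVariation]

theorem hasDerivAt_straightVariation (v : M → Euc (n + 1)) (Y : VecField n M) (p : M) :
    HasDerivAt (fun t => straightVariation v Y t p)
      (coordDifferential v p (Y p)) 0 := by
  simpa [straightVariation] using ((hasDerivAt_id (0 : ℝ)).smul_const
    (coordDifferential v p (Y p))).const_add (v p)

variable [IsManifold (𝓡 n) ∞ M]

theorem lieDeriv_eq_coordLieDeriv (Y : VecField n M) (β : TwoTensor n M) (p : M) :
    lieDeriv Y β p = coordLieDeriv Y β p (extChartAt (𝓡 n) p p) := by
  rw [lieDeriv, mfderiv_extChartAt_self]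
  rfl

/-- The Lie derivative of the metric induced by `v`: the second derivatives of `v` along `Y` and
the derivative of `Y` combine to the derivative of `dv(Y)`. -/
theorem coordLieDeriv_inducedMetric_apply {v : M → Euc (n + 1)}
    (hv : ContMDiff (𝓡 n) (𝓡 (n + 1)) 2 v) (Y : VecField n M) (p : M) (a b : Euc n) :
    letI y := extChartAt (𝓡 n) p p
    letI f := v ∘ (extChartAt (𝓡 n) p).symm
    letI D := fun c => fderiv ℝ (fderiv ℝ f) y (coordField Y p y) c
      + fderiv ℝ f y (fderiv ℝ (coordField Y p) y c)
    coordLieDeriv Y (inducedMetric v) p y a b =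
      inner ℝ (fderiv ℝ f y a) (D b) + inner ℝ (D a) (fderiv ℝ f y b) := by
  set y := extChartAt (𝓡 n) p p with hy
  set f := v ∘ (extChartAt (𝓡 n) p).symm with hf
  have hyt : y ∈ (extChartAt (𝓡 n) p).target := mem_extChartAt_target p
  have ho := isOpen_extChartAt_target (I := 𝓡 n) p
  have hβd : DifferentiableAt ℝ (coordTensor (inducedMetric v) p) y :=
    ((contDiffOn_coordTensor_inducedMetric (k := 1) hv p).contDiffAt
      (ho.mem_nhds hyt)).differentiableAt (by simp)
  have hfd : DifferentiableAt ℝ (fderiv ℝ f) y :=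
    (((contDiffOn_comp_extChartAt_symm (k := 2) hv p).fderiv_of_isOpen (m := 1) ho
      (by norm_num)).contDiffAt (ho.mem_nhds hyt)).differentiableAt (by simp)
  have hβ : ∀ z ∈ (extChartAt (𝓡 n) p).target, ∀ a b, coordTensor (inducedMetric v) p z a b =
      inner ℝ (fderiv ℝ f z a) (fderiv ℝ f z b) := fun z hz a b => by
    rw [coordTensor_inducedMetric hz (hv.mdifferentiable (by simp) _)]
    rfl
  have h1 : HasFDerivAt (fun z => coordTensor (inducedMetric v) p z a b) _ y :=
    (hβd.hasFDerivAt.clm_apply (hasFDerivAt_const a y)).clm_apply (hasFDerivAt_const b y)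
  have h2 : HasFDerivAt (fun z => inner ℝ (fderiv ℝ f z a) (fderiv ℝ f z b)) _ y :=
    (hfd.hasFDerivAt.clm_apply (hasFDerivAt_const a y)).inner ℝ
      (hfd.hasFDerivAt.clm_apply (hasFDerivAt_const b y))
  have h3 := congrArg (fun T => T (coordField Y p y)) (h1.unique (h2.congr_of_eventuallyEq
    (Filter.eventuallyEq_of_mem (ho.mem_nhds hyt) fun z hz => hβ z hz a b)))
  simp only [ContinuousLinearMap.comp_zero, zero_add, ContinuousLinearMap.flip_apply,
    ContinuousLinearMap.comp_apply, ContinuousLinearMap.prod_apply, fderivInnerCLM_apply] at h3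
  simp only [coordLieDeriv, add_apply, ContinuousLinearMap.bilinearComp_apply,
    ContinuousLinearMap.id_apply, inner_add_left, inner_add_right]
  rw [h3, hβ y hyt, hβ y hyt]
  ring

variable {ε : ℝ} {u : ℝ → M → Euc (n + 1)}

/-- The first variation of the metric induced by `u t` is the Lie derivative of the metric induced
by `u 0`, if the variational field is tangential. -/
theorem IsC2Family.hasDerivAt_inducedMetric (hu : IsC2Family n ε u) (hε : 0 < ε)
    {Y : VecField n M} (hY : IsSmoothField Y)
    (huY : ∀ p, HasDerivAt (fun t => u t p) (coordDifferential (u 0) p (Y p)) 0)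
    (p : M) (a b : Euc n) :
    HasDerivAt (fun t => inner ℝ (coordDifferential (u t) p a) (coordDifferential (u t) p b))
      (coordLieDeriv Y (inducedMetric (u 0)) p (extChartAt (𝓡 n) p p) a b) 0 := by
  have h0 : (0 : ℝ) ∈ Ioo (-ε) ε := ⟨by simpa, hε⟩
  have hyt : extChartAt (𝓡 n) p p ∈ (extChartAt (𝓡 n) p).target := mem_extChartAt_target p
  have hmem := (isOpen_Ioo_prod_target (n := n) ε p).mem_nhds 
    (mk_extChartAt_mem (n := n) h0 (mem_extChartAt_source p))
  have hU := (hu.contDiffOn p).contDiffAt hmem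
  have ho := isOpen_extChartAt_target (I := 𝓡 n) p
  have hu0 := hu.contMDiff h0
  have hYd : DifferentiableAt ℝ (coordField Y p) (extChartAt (𝓡 n) p p) :=
    ((contDiffOn_coordField hY p).contDiffAt (ho.mem_nhds hyt)).differentiableAt (by simp)
  have H := hasDerivAt_fderiv_of_deriv_eq hU hYd <| by
    filter_upwards [ho.mem_nhds hyt] with z hz
    have := huY ((extChartAt (𝓡 n) p).symm z)
    exact this.congr_deriv (fderiv_coordField (hu0.mdifferentiable (by simp)) Y hz).symm
  rw [coordLieDeriv_inducedMetric_apply hu0]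
  refine ((H a).inner ℝ (H b)).congr_of_eventuallyEq ?_
  filter_upwards [Ioo_mem_nhds h0.1 h0.2] with t ht
  rw [coordDifferential_eq ((hu.contMDiff ht).mdifferentiable (by simp) p)]
  rfl

/-- The first variation of the energy density. -/
theorem IsC2Family.deriv_mapEnergyDensity (hu : IsC2Family n ε u) (hε : 0 < ε)
    {Y : VecField n M} (hY : IsSmoothField Y)
    (huY : ∀ p, HasDerivAt (fun t => u t p) (coordDifferential (u 0) p (Y p)) 0)
    (ι : M → Euc (n + 1)) (p : M) :
    deriv (fun t => mapEnergyDensity (inducedMetric ι) (u t) p) 0 =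
      2 * tensorInner (inducedMetric ι) (fun q => inducedMetric (u 0) q - inducedMetric ι q)
        (lieDeriv Y (inducedMetric (u 0))) p := by
  rw [tensorInner, lieDeriv_eq_coordLieDeriv]
  refine (hasDerivAt_formInner (g := inducedMetric ι p)
    (S := fun t => inducedMetric (u t) p - inducedMetric ι p) (fun a b => ?_)
    fun a b => ?_).deriv
  · exact real_inner_comm (coordDifferential ι p b) (coordDifferential ι p a)
  · exact (hu.hasDerivAt_inducedMetric hε hY huY p a b).sub_const _

theorem contMDiff_coordDifferential_apply {v : M → Euc (n + 1)} (hv : ContMDiff (𝓡 n) (𝓡 (n + 1)) ∞ v)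
    {Y : VecField n M} (hY : IsSmoothField Y) :
    ContMDiff (𝓡 n) (𝓡 (n + 1)) ∞
      (fun p => (coordDifferential v p (Y p))) := by
  intro c
  have ho := isOpen_extChartAt_target (I := 𝓡 n) c
  have h1 : ContDiffOn ℝ ∞ (fun y => fderiv ℝ (v ∘ (extChartAt (𝓡 n) c).symm) y
      (coordField Y c y)) (extChartAt (𝓡 n) c).target :=
    ((contDiffOn_comp_extChartAt_symm (k := ⊤) hv c).fderiv_of_isOpen (m := ∞) ho
      (by simp)).clm_apply (contDiffOn_coordField hY c)
  have h2 := ((h1.contDiffAt (ho.mem_nhds (mem_extChartAt_target c))).contMDiffAt).comp c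
    (contMDiffAt_extChartAt (I := 𝓡 n) (n := ∞) (x := c))
  refine h2.congr_of_eventuallyEq ?_
  filter_upwards [extChartAt_source_mem_nhds (I := 𝓡 n) c] with p hp
  simp only [Function.comp_apply]
  refine Eq.trans ?_ (fderiv_coordField (hv.mdifferentiable (by simp)) Y
    ((extChartAt (𝓡 n) c).map_source hp)).symm
  rw [(extChartAt (𝓡 n) c).left_inv hp]
  rfl

theorem isC2Family_straightVariation {v : M → Euc (n + 1)}
    (hv : ContMDiff (𝓡 n) (𝓡 (n + 1)) ∞ v) {Y : VecField n M} (hY : IsSmoothField Y) :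
    IsC2Family n 1 (straightVariation v Y) := by
  have h2 : (2 : ℕ∞ω) ≤ ∞ := (mod_cast le_top : ((2 : ℕ∞) : ℕ∞ω) ≤ ∞)
  exact (((hv.of_le h2).comp contMDiff_snd).add
    (contMDiff_fst.smul (((contMDiff_coordDifferential_apply hv hY).of_le h2).comp
      contMDiff_snd))).contMDiffOn

/-- The first variation density is continuous: it is half the derivative at `0` of the energy
density along the straight variation, which is a `C²` family although it leaves the target
hypersurface. -/
theorem continuous_tensorInner_lieDeriv {ι v : M → Euc (n + 1)}
    (hι : Manifold.IsImmersion (𝓡 n) (𝓡 (n + 1)) ∞ ι) (hv : ContMDiff (𝓡 n) (𝓡 (n + 1)) ∞ v)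
    {Y : VecField n M} (hY : IsSmoothField Y) :
    Continuous (tensorInner (inducedMetric ι) (fun q => inducedMetric v q - inducedMetric ι q)
      (lieDeriv Y (inducedMetric v))) := by
  have hu := isC2Family_straightVariation hv hY
  have h1 := (hu.isChartwiseC1_mapEnergyDensity hι).continuous_deriv_zero one_pos
  have h2 := hu.deriv_mapEnergyDensity one_pos hY
    (by rw [straightVariation_zero]; exact hasDerivAt_straightVariation v Y) ι
  simp only [straightVariation_zero] at h2
  simp only [h2] at h1
  refine (h1.const_smul (2⁻¹ : ℝ)).congr fun p => ?_
  rw [Pi.smul_apply, smul_eq_mul, inv_mul_cancel_left₀ two_ne_zero]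

/-- The first variation formula for `C²` families of maps to `ℝⁿ⁺¹` with tangential variational
field. -/
theorem IsC2Family.hasDerivAt_integral [T2Space M] [CompactSpace M] [MeasurableSpace M]
    [BorelSpace M] (hu : IsC2Family n ε u) (hε : 0 < ε) {Y : VecField n M} (hY : IsSmoothField Y)
    (huY : ∀ p, HasDerivAt (fun t => u t p) (coordDifferential (u 0) p (Y p)) 0)
    {ι : M → Euc (n + 1)} (hι : Manifold.IsImmersion (𝓡 n) (𝓡 (n + 1)) ∞ ι) :
    HasDerivAt (fun t => ∫ p, mapEnergyDensity (inducedMetric ι) (u t) p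
        ∂(volumeMeasure (inducedMetric ι)))
      (2 * ∫ p, tensorInner (inducedMetric ι) (fun q => inducedMetric (u 0) q - inducedMetric ι q)
        (lieDeriv Y (inducedMetric (u 0))) p ∂(volumeMeasure (inducedMetric ι))) 0 := by
  have := isFiniteMeasure_volumeMeasure (hι.contMDiff.of_le (by simp : (1 : ℕ∞ω) ≤ ∞))
  have h := (hu.isChartwiseC1_mapEnergyDensity hι).hasDerivAt_integral
    (μ := volumeMeasure (inducedMetric ι)) hε
  simpa only [hu.deriv_mapEnergyDensity hε hY huY ι, integral_const_mul] using h

end FirstVariation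

/-! ### Flows on compact manifolds -/

section Flow

variable {n : ℕ} {M : Type*} [TopologicalSpace M] [ChartedSpace (Euc n) M]
  [IsManifold (𝓡 n) ∞ M]

theorem mfderiv_extChartAt_symm_coordField (Y : VecField n M) {c : M} {y : Euc n}
    (hy : y ∈ (extChartAt (𝓡 n) c).target) :
    (mfderiv (𝓡 n) (𝓡 n) (extChartAt (𝓡 n) c).symm y : Euc n →L[ℝ] Euc n) (coordField Y c y) =
      Y ((extChartAt (𝓡 n) c).symm y) := by
  have h := mfderivWithin_extChartAt_symm_comp_mfderiv_extChartAt (I := 𝓡 n) hy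
  rw [ModelWithCorners.range_eq_univ, mfderivWithin_univ] at h
  exact congrArg (fun T : Euc n →L[ℝ] Euc n => T (Y ((extChartAt (𝓡 n) c).symm y))) h

/-- A smooth vector field on a manifold has `C²` local flows. -/
theorem exists_localFlow_contMDiffOn {Y : VecField n M} (hY : IsSmoothField Y) (c : M) :
    ∃ ε > 0, ∃ V : Set M, IsOpen V ∧ c ∈ V ∧ ∃ β : ℝ → M → M,
      (∀ p ∈ V, β 0 p = p ∧
        IsMIntegralCurveOn (I := 𝓡 n) (fun t => β t p) Y (Ioo (-ε) ε)) ∧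
      ContMDiffOn (𝓘(ℝ, ℝ).prod (𝓡 n)) (𝓡 n) 2 (fun q : ℝ × M => β q.1 q.2)
        (Ioo (-ε) ε ×ˢ V) := by
  have h2 : IsManifold (𝓡 n) 2 M :=
    IsManifold.of_le (n := ∞) (mod_cast le_top : ((2 : ℕ∞) : ℕ∞ω) ≤ ∞)
  obtain ⟨r, hr, ε, hε, α, hα, hαc⟩ := exists_localFlow_contDiffOn 2
    (isOpen_extChartAt_target (I := 𝓡 n) c) (contDiffOn_coordField hY c)
    (mem_extChartAt_target (I := 𝓡 n) c)
  set V := (extChartAt (𝓡 n) c).source ∩ extChartAt (𝓡 n) c ⁻¹'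
    Metric.ball (extChartAt (𝓡 n) c c) r with hV
  refine ⟨ε, hε, V, (continuousOn_extChartAt c).isOpen_inter_preimage
    (isOpen_extChartAt_source c) Metric.isOpen_ball,
    ⟨mem_extChartAt_source c, Metric.mem_ball_self hr⟩,
    fun t p => (extChartAt (𝓡 n) c).symm (α (extChartAt (𝓡 n) c p) t), fun p hp => ⟨?_, ?_⟩, ?_⟩
  · simp only [(hα _ hp.2).1, (extChartAt (𝓡 n) c).left_inv hp.1]
  · intro t ht
    obtain ⟨h1, h3⟩ := (hα _ hp.2).2 t ht
    have h4 := ((mdifferentiableAt_extChartAt_symm h1).hasMFDerivAt.comp t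
      h3.hasFDerivAt.hasMFDerivAt).hasMFDerivWithinAt (s := Ioo (-ε) ε)
    refine h4.congr_mfderiv ?_
    refine ContinuousLinearMap.ext fun (s : ℝ) => ?_
    refine Eq.trans ?_ (congrArg (fun w : Euc n => s • w)
      (mfderiv_extChartAt_symm_coordField Y h1))
    exact map_smul (mfderiv (𝓡 n) (𝓡 n) (extChartAt (𝓡 n) c).symm
      (α (extChartAt (𝓡 n) c p) t) : Euc n →L[ℝ] Euc n) s _
  · have h5 : ContMDiffOn (𝓘(ℝ, ℝ).prod (𝓡 n)) 𝓘(ℝ, Euc n × ℝ) 2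
        (fun q : ℝ × M => (extChartAt (𝓡 n) c q.2, q.1)) (Ioo (-ε) ε ×ˢ V) := by
      refine ContMDiffOn.prodMk_space ?_ contMDiffOn_fst
      refine (contMDiffOn_extChartAt (I := 𝓡 n) (n := 2) (x := c)).comp contMDiffOn_snd
        fun q hq => ?_
      rw [mem_preimage, ← extChartAt_source (𝓡 n)]
      exact hq.2.1
    have h6 : ContMDiffOn (𝓘(ℝ, ℝ).prod (𝓡 n)) (𝓡 n) 2
        (fun q : ℝ × M => α (extChartAt (𝓡 n) c q.2) q.1) (Ioo (-ε) ε ×ˢ V) :=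
      (contMDiffOn_iff_contDiffOn.2 hαc).comp h5 fun q hq => ⟨hq.2.2, hq.1⟩
    exact (contMDiffOn_extChartAt_symm c).comp h6 fun q hq => ((hα _ hq.2.2).2 q.1 hq.1).1

theorem IsSmoothField.contMDiff_one {Y : VecField n M} (hY : IsSmoothField Y) :
    ContMDiff (𝓡 n) (𝓡 n).tangent 1 (fun p => (⟨p, Y p⟩ : TangentBundle (𝓡 n) M)) :=
  ContMDiff.of_le hY (by simp)

/-- A property of a time bound and a point which is inherited by smaller times, and which holds
locally, holds with a uniform time on a compact manifold. -/
theorem exists_pos_forall_of_compact [CompactSpace M] {P : ℝ → M → Prop}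
    (hmono : ∀ ε ε' p, ε' ≤ ε → P ε p → P ε' p) (h : ∀ c, ∃ ε > 0, ∀ᶠ p in 𝓝 c, P ε p) :
    ∃ ε > 0, ∀ p, P ε p := by
  have := isCompact_univ.induction_on (p := fun s : Set M => ∃ ε > 0, ∀ p ∈ s, P ε p)
    ⟨1, one_pos, by simp⟩ (fun s t hst ⟨ε, hε, H⟩ => ⟨ε, hε, fun p hp => H p (hst hp)⟩)
    (fun s t ⟨ε, hε, H⟩ ⟨ε', hε', H'⟩ => ⟨min ε ε', lt_min hε hε', fun p hp =>
      hp.elim (fun hp => hmono _ _ _ (min_le_left _ _) (H p hp))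
        fun hp => hmono _ _ _ (min_le_right _ _) (H' p hp)⟩)
    (fun c _ => by
      obtain ⟨ε, hε, H⟩ := h c
      exact ⟨_, mem_nhdsWithin_of_mem_nhds H, ε, hε, fun p hp => hp⟩)
  simpa using this

/-- Smooth vector fields on compact manifolds are complete. -/
theorem exists_isFlow [T2Space M] [CompactSpace M] {Y : VecField n M} (hY : IsSmoothField Y) :
    ∃ φ : ℝ → M → M, IsFlow Y φ := by
  have h1 : IsManifold (𝓡 n) 1 M := IsManifold.of_le (n := ∞) (by simp)
  obtain ⟨ε, hε, H⟩ := exists_pos_forall_of_compact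
    (P := fun ε p => ∃ γ : ℝ → M, γ 0 = p ∧ IsMIntegralCurveOn (I := 𝓡 n) γ Y (Ioo (-ε) ε))
    (fun ε ε' p hle ⟨γ, h0, hγ⟩ => ⟨γ, h0, hγ.mono (Ioo_subset_Ioo (neg_le_neg hle) hle)⟩)
    (fun c => by
      obtain ⟨ε, hε, V, hV, hc, β, hβ, -⟩ := exists_localFlow_contMDiffOn hY c
      exact ⟨ε, hε, Filter.eventually_of_mem (hV.mem_nhds hc) fun p hp => 
        ⟨fun t => β t p, hβ p hp⟩⟩)
  choose γ hγ using exists_isMIntegralCurve_of_isMIntegralCurveOn hY.contMDiff_one hε H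
  exact ⟨fun t p => γ p t, hγ⟩

/-- The flow of a smooth vector field on a compact manifold is `C²` for small times. -/
theorem IsFlow.exists_contMDiffOn [T2Space M] [CompactSpace M] {Y : VecField n M}
    (hY : IsSmoothField Y) {φ : ℝ → M → M} (hφ : IsFlow Y φ) :
    ∃ ε > 0, ContMDiffOn (𝓘(ℝ, ℝ).prod (𝓡 n)) (𝓡 n) 2 (fun q : ℝ × M => φ q.1 q.2)
      (Ioo (-ε) ε ×ˢ univ) := by
  have h1 : IsManifold (𝓡 n) 1 M := IsManifold.of_le (n := ∞) (by simp)
  obtain ⟨ε, hε, H⟩ := exists_pos_forall_of_compact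
    (P := fun ε p => ∀ t ∈ Ioo (-ε) ε,
      ContMDiffAt (𝓘(ℝ, ℝ).prod (𝓡 n)) (𝓡 n) 2 (fun q : ℝ × M => φ q.1 q.2) (t, p))
    (fun ε ε' p hle hp t ht => hp t (Ioo_subset_Ioo (neg_le_neg hle) hle ht))
    (fun c => by
      obtain ⟨ε, hε, V, hV, hc, β, hβ, hβc⟩ := exists_localFlow_contMDiffOn hY c
      refine ⟨ε, hε, Filter.eventually_of_mem (hV.mem_nhds hc) fun p hp t ht => ?_⟩
      have hmem : Ioo (-ε) ε ×ˢ V ∈ 𝓝 (t, p) := (isOpen_Ioo.prod hV).mem_nhds ⟨ht, hp⟩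
      refine (hβc.contMDiffAt hmem).congr_of_eventuallyEq ?_
      filter_upwards [hmem] with q hq
      exact isMIntegralCurveOn_Ioo_eqOn_of_contMDiff_boundaryless (t₀ := 0) (by simpa using hε)
        hY.contMDiff_one ((hφ q.2).2.isMIntegralCurveOn _) (hβ q.2 hq.2).2
        ((hφ q.2).1.trans (hβ q.2 hq.2).1.symm) hq.1)
  exact ⟨ε, hε, fun q hq => (H q.2 q.1 hq.1).contMDiffWithinAt⟩

end Flow

/-! ### The first variation of the deformation energy -/

section Energy

variable {n : ℕ} {M N : Type*} [TopologicalSpace M] [ChartedSpace (Euc n) M]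
  [TopologicalSpace N] [ChartedSpace (Euc n) N] {ιM : M → Euc (n + 1)} {ιN : N → Euc (n + 1)}

theorem strain_inducedMetric (g : TwoTensor n M) (hιN : MDifferentiable (𝓡 n) (𝓡 (n + 1)) ιN)
    {f : M → N} (hf : MDifferentiable (𝓡 n) (𝓡 n) f) :
    strain g (inducedMetric ιN) f = fun p => inducedMetric (ιN ∘ f) p - g p := by
  rw [← inducedMetric_comp hιN hf]
  rfl

theorem firstVariationDensity_inducedMetric (g : TwoTensor n M)
    (hιN : MDifferentiable (𝓡 n) (𝓡 (n + 1)) ιN) {f : M → N}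
    (hf : MDifferentiable (𝓡 n) (𝓡 n) f) (Y : VecField n M) :
    firstVariationDensity g (inducedMetric ιN) f Y =
      tensorInner g (fun p => inducedMetric (ιN ∘ f) p - g p)
        (lieDeriv Y (inducedMetric (ιN ∘ f))) := by
  funext p
  rw [firstVariationDensity, strain_inducedMetric g hιN hf, inducedMetric_comp hιN hf]

variable [IsManifold (𝓡 n) ∞ M]

theorem energy_inducedMetric [T2Space M] [SigmaCompactSpace M] [MeasurableSpace M]
    (g : TwoTensor n M) (hιN : MDifferentiable (𝓡 n) (𝓡 (n + 1)) ιN)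
    {f : M → N} (hf : MDifferentiable (𝓡 n) (𝓡 n) f) :
    energy g (inducedMetric ιN) f = ∫ p, mapEnergyDensity g (ιN ∘ f) p ∂(volumeMeasure g) := by
  rw [energy, strain_inducedMetric g hιN hf]
  rfl

/-- The first variation formula for families `F` of maps `M → N` which are `C²` in the time and the
point. -/
theorem hasDerivAt_energy [T2Space M] [CompactSpace M] [MeasurableSpace M] [BorelSpace M]
    (hιM : Manifold.IsImmersion (𝓡 n) (𝓡 (n + 1)) ∞ ιM)
    (hιN : ContMDiff (𝓡 n) (𝓡 (n + 1)) ∞ ιN) {h : M → N}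
    {Y : VecField n M} (hY : IsSmoothField Y) {ε : ℝ} (hε : 0 < ε) {F : ℝ → M → N}
    (hF : ContMDiffOn (𝓘(ℝ, ℝ).prod (𝓡 n)) (𝓡 n) 2 (fun q : ℝ × M => F q.1 q.2)
      (Ioo (-ε) ε ×ˢ univ)) (hF0 : F 0 = h)
    (hFY : ∀ p, (variationField F p : Euc n) =
      (mfderiv (𝓡 n) (𝓡 n) h p : Euc n →L[ℝ] Euc n) (Y p)) :
    HasDerivAt (fun t => energy (inducedMetric ιM) (inducedMetric ιN) (F t))
      (2 * ∫ p, firstVariationDensity (inducedMetric ιM) (inducedMetric ιN) h Y p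
        ∂(volumeMeasure (inducedMetric ιM))) 0 := by
  subst hF0
  have h0 : (0 : ℝ) ∈ Ioo (-ε) ε := ⟨by simpa, hε⟩
  have h2 : (2 : ℕ∞ω) ≤ ∞ := (mod_cast le_top : ((2 : ℕ∞) : ℕ∞ω) ≤ ∞)
  have hιNd : MDifferentiable (𝓡 n) (𝓡 (n + 1)) ιN := hιN.mdifferentiable (by simp)
  have hFd : ∀ t ∈ Ioo (-ε) ε, MDifferentiable (𝓡 n) (𝓡 n) (F t) := by
    intro t ht
    have : ContMDiff (𝓡 n) (𝓡 n) 2 (F t) := by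
      rw [← contMDiffOn_univ]
      exact hF.comp (f := fun p : M => (t, p))
        (contMDiff_const.prodMk contMDiff_id).contMDiffOn fun p _ => ⟨ht, mem_univ p⟩
    exact this.mdifferentiable (by simp)
  have hu : IsC2Family n ε fun t => ιN ∘ F t :=
    (hιN.of_le h2).comp_contMDiffOn hF
  have huY : ∀ p, HasDerivAt (fun t => (ιN ∘ F t) p) (coordDifferential (ιN ∘ F 0) p (Y p)) 0 := by
    intro p
    have hFp : MDifferentiableAt 𝓘(ℝ, ℝ) (𝓡 n) (fun t => F t p) 0 := by
      have : ContMDiffAt 𝓘(ℝ, ℝ) (𝓡 n) 2 (fun t => F t p) 0 :=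
        ContMDiffAt.comp (g := fun q : ℝ × M => F q.1 q.2) (f := fun t : ℝ => (t, p)) (0 : ℝ)
          (hF.contMDiffAt ((isOpen_Ioo.prod isOpen_univ).mem_nhds ⟨h0, mem_univ p⟩))
          (contMDiff_id.prodMk contMDiff_const).contMDiffAt
      exact this.mdifferentiableAt (by simp)
    let L : ℝ →L[ℝ] Euc (n + 1) :=
      (mfderiv (𝓡 n) (𝓡 (n + 1)) ιN (F 0 p) : Euc n →L[ℝ] Euc (n + 1)).comp
        (mfderiv 𝓘(ℝ, ℝ) (𝓡 n) (fun t => F t p) 0 : ℝ →L[ℝ] Euc n)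
    have h3 : HasFDerivAt (fun t => (ιN ∘ F t) p) L 0 :=
      hasMFDerivAt_iff_hasFDerivAt.1 ((hιNd (F 0 p)).hasMFDerivAt.comp (0 : ℝ) hFp.hasMFDerivAt)
    refine h3.hasDerivAt.congr_deriv ?_
    have h4 := congrArg (mfderiv (𝓡 n) (𝓡 (n + 1)) ιN (F 0 p) : Euc n →L[ℝ] Euc (n + 1)) (hFY p)
    refine Eq.trans h4 ?_
    rw [coordDifferential, mfderiv_comp p (hιNd _) (hFd 0 h0 p)]
    rfl
  have H := hu.hasDerivAt_integral hε hY huY hιM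
  rw [firstVariationDensity_inducedMetric _ hιNd (hFd 0 h0)]
  refine H.congr_of_eventuallyEq ?_
  filter_upwards [Ioo_mem_nhds h0.1 h0.2] with t ht
  exact energy_inducedMetric _ hιNd (hFd t ht)

/-- The first variation formula for the flow of `Y`. -/
theorem hasDerivAt_energy_comp_flow [T2Space M] [CompactSpace M] [MeasurableSpace M] [BorelSpace M]
    (hιM : Manifold.IsImmersion (𝓡 n) (𝓡 (n + 1)) ∞ ιM)
    (hιN : ContMDiff (𝓡 n) (𝓡 (n + 1)) ∞ ιN) {h : M → N} (hh : ContMDiff (𝓡 n) (𝓡 n) ∞ h)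
    {Y : VecField n M} (hY : IsSmoothField Y) {φ : ℝ → M → M} (hφ : IsFlow Y φ) :
    HasDerivAt (fun t => energy (inducedMetric ιM) (inducedMetric ιN) (h ∘ φ t))
      (2 * ∫ p, firstVariationDensity (inducedMetric ιM) (inducedMetric ιN) h Y p
        ∂(volumeMeasure (inducedMetric ιM))) 0 := by
  obtain ⟨ε, hε, hφc⟩ := hφ.exists_contMDiffOn hY
  have h2 : (2 : ℕ∞ω) ≤ ∞ := (mod_cast le_top : ((2 : ℕ∞) : ℕ∞ω) ≤ ∞)
  refine hasDerivAt_energy hιM hιN hY hε (F := fun t => h ∘ φ t)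
    ((hh.of_le h2).comp_contMDiffOn hφc) ?_ fun p => ?_
  · funext p
    simp [(hφ p).1]
  · have h3 := ((hh.mdifferentiable (by simp) (φ 0 p)).hasMFDerivAt.comp (0 : ℝ)
      ((hφ p).2 0)).mfderiv
    have h4 := congrArg (fun T : ℝ →L[ℝ] Euc n => T 1) h3
    have h5 : ∀ q, q = p → (mfderiv (𝓡 n) (𝓡 n) h q : Euc n →L[ℝ] Euc n) (Y q) =
        (mfderiv (𝓡 n) (𝓡 n) h p : Euc n →L[ℝ] Euc n) (Y p) := by
      rintro q rfl
      rfl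
    refine Eq.trans h4 (Eq.trans ?_ (h5 (φ 0 p) (hφ p).1))
    exact congrArg (mfderiv (𝓡 n) (𝓡 n) h (φ 0 p) : Euc n →L[ℝ] Euc n) (one_smul ℝ _)

end Energy

end BendingEnergy

end

theorem mainTheorem7 (n : ℕ) {M N : Type*}
    [TopologicalSpace M] [T2Space M] [CompactSpace M] [ChartedSpace (BendingEnergy.Euc n) M]
    [IsManifold (𝓡 n) ∞ M] [MeasurableSpace M] [BorelSpace M]
    [TopologicalSpace N] [T2Space N] [CompactSpace N] [ChartedSpace (BendingEnergy.Euc n) N]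
    [IsManifold (𝓡 n) ∞ N]
    (ιM : M → BendingEnergy.Euc (n + 1)) (ιN : N → BendingEnergy.Euc (n + 1))
    (hιM : Manifold.IsSmoothEmbedding (𝓡 n) (𝓡 (n + 1)) ∞ ιM)
    (hιN : Manifold.IsSmoothEmbedding (𝓡 n) (𝓡 (n + 1)) ∞ ιN)
    (gM : BendingEnergy.TwoTensor n M) (hgM : gM = BendingEnergy.inducedMetric ιM)
    (gN : BendingEnergy.TwoTensor n N) (hgN : gN = BendingEnergy.inducedMetric ιN)
    (h : M ≃ₘ^∞⟮𝓡 n, 𝓡 n⟯ N) :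
    (∀ Y : BendingEnergy.VecField n M, BendingEnergy.IsSmoothField Y →
      Integrable (BendingEnergy.firstVariationDensity gM gN h Y)
        (BendingEnergy.volumeMeasure gM) ∧
      (∀ φ : ℝ → M → M, BendingEnergy.IsFlow Y φ →
        HasDerivAt (fun t => BendingEnergy.energy gM gN (h ∘ φ t))
          (2 * ∫ p, BendingEnergy.firstVariationDensity gM gN h Y p
            ∂(BendingEnergy.volumeMeasure gM)) 0) ∧
      (∀ (ε : ℝ) (F : ℝ → M → N), 0 < ε → BendingEnergy.IsSmoothVariation h ε F →
        (∀ p, BendingEnergy.variationField F p = mfderiv (𝓡 n) (𝓡 n) h p (Y p)) →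
        HasDerivAt (fun t => BendingEnergy.energy gM gN (F t))
          (2 * ∫ p, BendingEnergy.firstVariationDensity gM gN h Y p
            ∂(BendingEnergy.volumeMeasure gM)) 0)) ∧
    (BendingEnergy.IsCriticalPoint gM gN h ↔
      ∀ Y : BendingEnergy.VecField n M, BendingEnergy.IsSmoothField Y →
        ∫ p, BendingEnergy.firstVariationDensity gM gN h Y p
          ∂(BendingEnergy.volumeMeasure gM) = 0) := by
  subst hgM hgN
  have hM := hιM.isImmersion
  have hN := hιN.contMDiff
  have hh : ContMDiff (𝓡 n) (𝓡 n) ∞ h := h.contMDiff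
  have := BendingEnergy.isFiniteMeasure_volumeMeasure
    (hιM.contMDiff.of_le (by simp : (1 : ℕ∞ω) ≤ ∞))
  refine ⟨fun Y hY => ⟨?_, fun φ hφ => ?_, fun ε F hε hF hFY => ?_⟩, fun H Y hY => ?_,
    fun H Y hY φ hφ => ?_⟩
  · rw [BendingEnergy.firstVariationDensity_inducedMetric _ (hN.mdifferentiable (by simp))
      (hh.mdifferentiable (by simp))]
    exact BendingEnergy.integrable_of_continuous_of_compact
      (BendingEnergy.continuous_tensorInner_lieDeriv hM (hN.comp hh) hY)
  · exact BendingEnergy.hasDerivAt_energy_comp_flow hM hN hh hY hφ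
  · exact BendingEnergy.hasDerivAt_energy hM hN hY hε
      (hF.smooth.of_le (mod_cast le_top : ((2 : ℕ∞) : ℕ∞ω) ≤ ∞)) hF.zero hFY
  · obtain ⟨φ, hφ⟩ := BendingEnergy.exists_isFlow hY
    have h1 := (BendingEnergy.hasDerivAt_energy_comp_flow hM hN hh hY hφ).unique (H Y hY φ hφ)
    simpa using h1
  · simpa [H Y hY] using BendingEnergy.hasDerivAt_energy_comp_flow hM hN hh hY hφ
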